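/- Let $p$ be a prime number. For a group $S$ the $p$-Zassenhaus filtration is defined by $S_{(1,p)}=S$ and $S_{(i,p)}=(S_{(\lceil i/p\rceil,p)})^p\prod_{j+l=i,\ j,l\ge 1}[S_{(j,p)},S_{(l,p)}]$ for $i\geq 2$, where $H^p$ is the subgroup generated by the $p$-th powers of elements of $H$; for a profinite group $S$ all subgroups are taken to be closed. Let $\mathbb{U}_n(\mathbb{F}_p)$ be the (discrete) group of upper-triangular unipotent $n\times n$ matrices over $\mathbb{F}_p$. (1) If $S$ is a free (discrete) group on a finite set, then for every $n\geq1$, $S_{(n,p)}=\bigcap\operatorname{Ker}(\varphi)$, where $\varphi$ ranges over all homomorphisms $S\to\mathbb{U}_n(\mathbb{F}_p)$. (2) Let $\Pi$ be a set of prime numbers, let $\mathcal{C}$ be the class of all finite groups whose order is a product of primes in $\Pi$, and let $S$ be a free pro-$\mathcal{C}$ group on an arbitrary (possibly infinite) basis $A$: that is, a pro-$\mathcal{C}$ group with a map $\iota\colon A\to S$ converging to $1$ whose image topologically generates $S$, such that every map from $A$ to a pro-$\mathcal{C}$ group $G$ that converges to $1$ factors as $\hat\varphi\circ\iota$ for a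 unique continuous homomorphism $\hat\varphi\colon S\to G$. (A map from $A$ to a profinite group converges to $1$ if every open normal subgroup contains the images of all but finitely many elements of $A$.) Then for every $n\geq1$, $S_{(n,p)}=\bigcap\operatorname{Ker}(\varphi)$, where $\varphi$ ranges over all continuous homomorphisms $S\to\mathbb{U}_n(\mathbb{F}_p)$. (3) Let $D_4$ be the dihedral group of order $8$ and, for $p>2$, let $H_{p^3}$ be the unique non-abelian group of order $p^3$ and exponent $p$. Then $\mathbb{U}_3(\mathbb{F}_2)\cong D_4$, and $\mathbb{U}_3(\mathbb{F}_p)\cong H_{p^3}$ for $p>2$. Up to isomorphism, the subgroups of $\mathbb{U}_3(\mathbb{F}_p)$ are exactly $\{1\},\mathbb{Z}/2,(\mathbb{Z}/2)^2,\mathbb{Z}/4,D_4$ if $p=2$, and $\{1\},\mathbb{Z}/p,(\mathbb{Z}/p)^2,H_{p^3}$ if $p>2$. (4) For a profinite group $S$ and a list $\mathcal{L}$ of finite groups let $S_{\mathcal{L}}$ be the intersection of the kernels of all continuous epimorphisms from $S$ onto groups in $\mathcal{L}$. If $S$ is a free profinite group on an arbitrary basis (the case of (2) where $\Pi$ is the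 set of all primes), then $S_{(3,p)}=\bigcap\operatorname{Ker}(\varphi)$, where $\varphi$ ranges over all continuous homomorphisms $S\to\mathbb{U}_3(\mathbb{F}_p)$, and $S_{(3,p)}=S_{\mathcal{L}}$, where $\mathcal{L}$ is the list of (3). Furthermore, $S_{(3,p)}=S_{\mathcal{L}'}$, where $\mathcal{L}'=\{1,\mathbb{Z}/2,\mathbb{Z}/4,D_4\}$ if $p=2$ and $\mathcal{L}'=\{1,\mathbb{Z}/p,H_{p^3}\}$ if $p>2$. -/

import Mathlib

open scoped Topology commutatorElement

universe u v

namespace ZassenhausKernel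

/-- The subgroup `H^p` generated by all `p`-th powers of elements of `H`. -/
def powSubgroup {G : Type u} [Group G] (p : ℕ) (H : Subgroup G) : Subgroup G :=
  Subgroup.closure ((fun h : G => h ^ p) '' (H : Set G))

theorem ceilDiv_lt (p : ℕ) [hp : Fact p.Prime] (i : ℕ) : (i + 2) ⌈/⌉ p < i + 2 := by
  have h2 : 2 ≤ p := hp.out.two_le
  rw [Nat.ceilDiv_eq_add_pred_div, Nat.div_lt_iff_lt_mul (by omega)]
  have : (i + 2) * 2 ≤ (i + 2) * p := Nat.mul_le_mul_left _ h2
  nlinarith [Nat.sub_add_cancel (show 1 ≤ i + 2 + p by omega)]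

/-- The `p`-Zassenhaus filtration `G_{(i,p)}` of an abstract group: `G_{(1,p)} = G` and, for
`i ≥ 2`, `G_{(i,p)} = (G_{(⌈i/p⌉,p)})^p ∏_{j+l=i} [G_{(j,p)}, G_{(l,p)}]` with `j, l ≥ 1`.
The value at index `0` is a dummy. -/
def zassenhaus (G : Type u) [Group G] (p : ℕ) [Fact p.Prime] : ℕ → Subgroup G
  | 0 => ⊤
  | 1 => ⊤
  | i + 2 =>
      powSubgroup p (zassenhaus G p ((i + 2) ⌈/⌉ p)) ⊔
        ⨆ j : Fin (i + 1), ⁅zassenhaus G p (j + 1), zassenhaus G p (i + 1 - j)⁆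
termination_by i => i
decreasing_by
  · exact ceilDiv_lt p i
  · omega
  · omega

/-- The `p`-Zassenhaus filtration of a topological group: the same recursion, with all
subgroups taken to be closed. -/
def closedZassenhaus (G : Type u) [Group G] [TopologicalSpace G] [IsTopologicalGroup G]
    (p : ℕ) [Fact p.Prime] : ℕ → Subgroup G
  | 0 => ⊤
  | 1 => ⊤
  | i + 2 =>
      (powSubgroup p (closedZassenhaus G p ((i + 2) ⌈/⌉ p)) ⊔
        ⨆ j : Fin (i + 1),
          ⁅closedZassenhaus G p (j + 1), closedZassenhaus G p (i + 1 - j)⁆).topologicalClosure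
termination_by i => i
decreasing_by
  · exact ceilDiv_lt p i
  · omega
  · omega

/-- The group `U_n(R)` of upper-triangular unipotent `n × n` matrices over `R`. -/
def unipotent (n : ℕ) (R : Type u) [CommRing R] : Subgroup (GL (Fin n) R) where
  carrier := {g | (∀ i j, j < i → g.1 i j = 0) ∧ ∀ i, g.1 i i = 1}
  one_mem' := ⟨fun i j h => by simp [h.ne'], fun i => by simp⟩
  mul_mem' := by
    rintro a b ⟨ha, ha'⟩ ⟨hb, hb'⟩
    refine ⟨fun i j h => ?_, fun i => ?_⟩
    · simp only [Units.val_mul, Matrix.mul_apply]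
      refine Finset.sum_eq_zero fun k _ => ?_
      rcases lt_or_ge k i with hk | hk
      · rw [ha i k hk, zero_mul]
      · rw [hb k j (h.trans_le hk), mul_zero]
    · simp only [Units.val_mul, Matrix.mul_apply]
      rw [Finset.sum_eq_single i, ha', hb', one_mul]
      · intro k _ hk
        rcases lt_or_gt_of_ne hk with hk | hk
        · rw [ha i k hk, zero_mul]
        · rw [hb k i hk, mul_zero]
      · simp
  inv_mem' := by
    rintro a ⟨ha, ha'⟩
    let _ := a.invertible
    have hT : Matrix.BlockTriangular a.1 id := fun i j h => ha i j h
    have hI : Matrix.BlockTriangular (a⁻¹).1 id := by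
      have := Matrix.blockTriangular_inv_of_blockTriangular hT
      rwa [← Matrix.coe_units_inv] at this
    refine ⟨fun i j h => hI h, fun i => ?_⟩
    have h1 : (a.1 * (a⁻¹).1) i i = 1 := by
      rw [← Units.val_mul, mul_inv_cancel]; simp
    rw [Matrix.mul_apply, Finset.sum_eq_single i, ha', one_mul] at h1
    · exact h1
    · intro k _ hk
      rcases lt_or_gt_of_ne hk with hk | hk
      · rw [ha i k hk, zero_mul]
      · rw [hI hk, mul_zero]
    · simp

/-- The kernel intersection: the intersection of the kernels of all homomorphisms `H → G`. -/
def kerInt (H : Type u) (G : Type v) [Group H] [Group G] : Subgroup H :=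
  ⨅ φ : H →* G, φ.ker

/-- The intersection of the kernels of all continuous homomorphisms `H → G`, where `G` carries
the discrete topology. -/
def kerIntCont (H : Type u) (G : Type v) [Group H] [TopologicalSpace H] [Group G] : Subgroup H :=
  ⨅ (φ : H →* G) (_ : Continuous[inferInstance, ⊥] φ), φ.ker

/-- `H_𝓛`: the intersection of the kernels of all continuous epimorphisms from `H` onto a
(discrete) group belonging to the list `𝓛`. -/
def listKernel (H : Type u) [Group H] [TopologicalSpace H] (𝓛 : Set GrpCat.{0}) : Subgroup H :=
  ⨅ (K : GrpCat.{0}) (_ : K ∈ 𝓛) (φ : H →* K)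
    (_ : Continuous[inferInstance, ⊥] φ ∧ Function.Surjective φ), φ.ker

/-- A pro-`𝓒` group, for `𝓒` the class of finite groups whose order is a product of primes
in `Π`: a profinite group all of whose quotients by open normal subgroups are in `𝓒`. -/
structure IsProC (primes : Set ℕ) (G : Type u) [Group G] [TopologicalSpace G]
    [IsTopologicalGroup G] : Prop where
  compact : CompactSpace G
  hausdorff : T2Space G
  totallyDisconnected : TotallyDisconnectedSpace G
  quotients : ∀ N : Subgroup G, N.Normal → IsOpen (N : Set G) →
    ∀ q : ℕ, q.Prime → q ∣ Nat.card (G ⧸ N) → q ∈ primes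

/-- A map `φ : A → G` converges to `1` if every open normal subgroup of `G` contains `φ a` for
all but finitely many `a`. -/
def ConvergesToOne {A : Type v} {G : Type u} [Group G] [TopologicalSpace G] (φ : A → G) : Prop :=
  ∀ N : Subgroup G, N.Normal → IsOpen (N : Set G) → {a | φ a ∉ N}.Finite

/-- `S` is a free pro-`𝓒` group on basis `A` with respect to `ι : A → S`, where `𝓒` is the class
of finite groups whose order is a product of primes in the given set. -/
structure IsFreeProC (primes : Set ℕ) {A : Type v} {S : Type u} [Group S] [TopologicalSpace S]
    [IsTopologicalGroup S] (ι : A → S) : Prop where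
  isProC : IsProC primes S
  convergesToOne : ConvergesToOne ι
  generates : (Subgroup.closure (Set.range ι)).topologicalClosure = ⊤
  lift : ∀ (G : Type u) [Group G] [TopologicalSpace G] [IsTopologicalGroup G], IsProC primes G →
    ∀ φ : A → G, ConvergesToOne φ → ∃! f : S →ₜ* G, ∀ a, f (ι a) = φ a

/-- The cyclic group `ℤ/m`, written multiplicatively. -/
abbrev cyclic (m : ℕ) : GrpCat.{0} := GrpCat.of (Multiplicative (ZMod m))

/-- The group `(ℤ/m)²`, written multiplicatively. -/
abbrev cyclicSq (m : ℕ) : GrpCat.{0} := GrpCat.of (Multiplicative (ZMod m × ZMod m))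

/-- `H` is a non-abelian group of order `p³` and exponent `p` (for odd `p` there is exactly one
such group up to isomorphism, denoted `H_{p³}`). -/
def IsHeisenberg (p : ℕ) (H : Type) [Group H] : Prop :=
  Nat.card H = p ^ 3 ∧ Monoid.exponent H = p ∧ ∃ a b : H, a * b ≠ b * a

/-- The list `{1, ℤ/2, ℤ/4, D₄}`, with `D₄` the dihedral group of order `8`. -/
def listTwo : Set GrpCat.{0} :=
  {cyclic 1, cyclic 2, cyclic 4, GrpCat.of (DihedralGroup 4)}

/-- The list `{1, ℤ/p, H_{p³}}`. -/
def listOdd (p : ℕ) : Set GrpCat.{0} :=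
  {cyclic 1, cyclic p} ∪ {H | IsHeisenberg p H}

end ZassenhausKernel

/-! One inclusion is formal. Call a descending series compatible with commutators and `p`-th powers
an Np-series. The Zassenhaus filtration is the smallest one, its closed version the smallest with
closed terms (`IsNpSeries.zassenhaus_le`, `IsNpSeries.closedZassenhaus_le`). Filtering matrices by
superdiagonals gives an Np-series on `U_n(𝔽_p)` with trivial `n`-th term, so every homomorphism to
`U_n(𝔽_p)` kills `S_{(n,p)}`.

For the other inclusion, let `h` die in every `U_n(𝔽_p)`, and pass to a finite quotient `φ : S → P`
with `P_{(n,p)} = 1`. It suffices to show `φ h = 1`. Let `I` be the augmentation ideal of `𝔽_p[P]`.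
Two facts combine in `eq_one_of_wordMatrix`.

Magnus expansion (`sub_sum_magnusPart_mem`): modulo `I^n`, `φ h` is the sum over words `w` of length
below `n` of `c_w(h) ∏ (φ s_{w_i} - 1)`. The coefficient `c_w(h)` is the top-row entry in column
`|w|` (counting from 0) of the image of `h` under the homomorphism to `U_n(𝔽_p)` that sends each
generator to its `wordMatrix`. Freeness provides these homomorphisms. By assumption they kill `h`,
so only the constant term remains and `φ h - 1 ∈ I^n`.

Jennings' theorem (`eq_one_of_of_sub_one_mem`): if `P_{(n,p)} = 1` and `g - 1 ∈ I^n`, then `g = 1`.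
Choose weighted generators `x_i` adapted to the filtration, at most `log_p |P|` of them. A
collecting process shows that the ordered monomials in the `x_i - 1` with exponents below `p` and
weight at least `d` span `I^d`. There are at most `dim 𝔽_p[P]` monomials in all, so they form a
basis, and `x_i - 1` lies no deeper than its weight. A nontrivial `g` can itself be made one of the
`x_i`.

In the discrete case `P = S / S_{(n,p)}` is finite because `S` is finitely generated. In the pro-`𝓒`
case `P` is a quotient by an open normal subgroup that contains `S_{(n,p)}`, and density replaces
`h` by an element of the abstract group generated by the basis.

For `n = 3`, `U_3(𝔽_p)` is the Heisenberg group. A homomorphism into it is an epimorphism onto one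
of its subgroups, so classifying these turns kernel intersections into list kernels. -/

namespace ZassenhausKernel

/-! ### Np-series and the minimality of the Zassenhaus filtration -/

section Basics

variable {G : Type u} [Group G] (p : ℕ)

theorem powSubgroup_mono {H K : Subgroup G} (h : H ≤ K) : powSubgroup p H ≤ powSubgroup p K :=
  Subgroup.closure_mono (Set.image_mono h)

theorem powSubgroup_le {H K : Subgroup G} : powSubgroup p H ≤ K ↔ ∀ h ∈ H, h ^ p ∈ K := by
  simp [powSubgroup, Subgroup.closure_le, Set.subset_def]

theorem pow_mem_powSubgroup {H : Subgroup G} {h : G} (hh : h ∈ H) : h ^ p ∈ powSubgroup p H :=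
  (powSubgroup_le p).1 le_rfl h hh

/-- A descending series of normal subgroups `Z 1 = G ≥ Z 2 ≥ ⋯` which is compatible with
commutators and `p`-th powers. -/
structure IsNpSeries (Z : ℕ → Subgroup G) : Prop where
  zero : Z 0 = ⊤
  one : Z 1 = ⊤
  antitone : Antitone Z
  commutator : ∀ {i j x y}, x ∈ Z i → y ∈ Z j → ⁅x, y⁆ ∈ Z (i + j)
  pow_mem : ∀ {i x}, x ∈ Z i → x ^ p ∈ Z (p * i)

theorem IsNpSeries.normal {Z : ℕ → Subgroup G} (h : IsNpSeries p Z) (i : ℕ) : (Z i).Normal where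
  conj_mem x hx g := by
    have h1 : ⁅g, x⁆ ∈ Z i :=
      h.antitone (Nat.le_add_left i 1) (h.commutator (h.one ▸ Subgroup.mem_top g) hx)
    simpa [commutatorElement_def] using mul_mem h1 hx

theorem IsNpSeries.map {H : Type v} [Group H] {Y : ℕ → Subgroup H} (hY : IsNpSeries p Y)
    (φ : H →* G) (hφ : Function.Surjective φ) : IsNpSeries p fun i => (Y i).map φ where
  zero := by simp [hY.zero, Subgroup.map_top_of_surjective φ hφ]
  one := by simp [hY.one, Subgroup.map_top_of_surjective φ hφ]
  antitone _ _ hij := Subgroup.map_mono (hY.antitone hij)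
  commutator := by
    rintro i j _ _ ⟨x, hx, rfl⟩ ⟨y, hy, rfl⟩
    exact ⟨⁅x, y⁆, hY.commutator hx hy, map_commutatorElement φ x y⟩
  pow_mem := by
    rintro i _ ⟨x, hx, rfl⟩
    exact ⟨x ^ p, hY.pow_mem hx, map_pow φ x p⟩

theorem IsNpSeries.comap {Z : ℕ → Subgroup G} (hZ : IsNpSeries p Z) {H : Type v} [Group H]
    (φ : H →* G) : IsNpSeries p fun i => (Z i).comap φ where
  zero := by simp [hZ.zero]
  one := by simp [hZ.one]
  antitone _ _ hij := Subgroup.comap_mono (hZ.antitone hij)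
  commutator hx hy := by
    simpa only [Subgroup.mem_comap, map_commutatorElement] using hZ.commutator hx hy
  pow_mem hx := by simpa using hZ.pow_mem hx

variable [hp : Fact p.Prime]

theorem IsNpSeries.pow_mem_succ {Z : ℕ → Subgroup G} (h : IsNpSeries p Z) {i : ℕ} {x : G}
    (hx : x ∈ Z i) : x ^ p ∈ Z (i + 1) := by
  rcases Nat.eq_zero_or_pos i with rfl | hi
  · simp [h.one]
  · refine h.antitone ?_ (h.pow_mem hx)
    nlinarith [hp.out.two_le]

theorem IsNpSeries.pow_pow_mem {Z : ℕ → Subgroup G} (h : IsNpSeries p Z) (x : G) (k : ℕ) :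
    x ^ p ^ k ∈ Z k := by
  induction k with
  | zero => simp [h.zero]
  | succ k ih => rw [pow_succ, pow_mul]; exact h.pow_mem_succ p ih

theorem IsNpSeries.isPGroup {Z : ℕ → Subgroup G} (h : IsNpSeries p Z) {n : ℕ} (hn : Z n = ⊥) :
    IsPGroup p G := fun x => ⟨n, by simpa [hn] using h.pow_pow_mem p x n⟩

/-- A series that satisfies the recursion of the Zassenhaus filtration, up to a closure
operation `c`. -/
theorem isNpSeries_of_rec {Z : ℕ → Subgroup G} (c : Subgroup G → Subgroup G) (hc : Monotone c)
    (hle : ∀ H, H ≤ c H) (h0 : Z 0 = ⊤) (h1 : Z 1 = ⊤)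
    (hZ : ∀ i, Z (i + 2) = c (powSubgroup p (Z ((i + 2) ⌈/⌉ p)) ⊔
      ⨆ j : Fin (i + 1), ⁅Z (j + 1), Z (i + 1 - j)⁆)) : IsNpSeries p Z := by
  have hp2 := hp.out.two_le
  have step : ∀ i, Z (i + 1) ≤ Z i := by
    intro i
    induction i using Nat.strong_induction_on with
    | _ i ih =>
      match i with
      | 0 => simp [h0]
      | 1 => simp [h1]
      | i + 2 =>
        -- Monotonicity up to level `i + 2` is all that comparing the recursions for levels `i + 3`
        -- and `i + 2` needs.
        have anti : ∀ a b, a ≤ b → b ≤ i + 2 → Z b ≤ Z a := by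
          intro a b hab
          induction b, hab using Nat.le_induction with
          | base => exact fun _ => le_rfl
          | succ b hb ihb => exact fun hb' => (ih b (by omega)).trans (ihb (by omega))
        rw [hZ (i + 1), hZ i]
        refine hc (sup_le_sup (powSubgroup_mono p (anti _ _ ?_ ?_)) (iSup_le fun j => ?_))
        · simp only [Nat.ceilDiv_eq_add_pred_div]
          exact Nat.div_le_div_right (by omega)
        · have := ceilDiv_lt p (i + 1); omega
        -- One of the two commutator indices must drop by one and stay positive: the second when the
        -- first is already `1`, the first otherwise.
        · rcases Nat.eq_zero_or_pos (j : ℕ) with hj | hj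
          · refine le_trans (Subgroup.commutator_mono (le_refl _) (anti (i + 1) _ ?_ ?_))
              (le_iSup_of_le (⟨0, by omega⟩ : Fin (i + 1)) ?_)
            · omega
            · omega
            · simp [hj]
          · refine le_trans (Subgroup.commutator_mono (anti (j - 1 + 1) _ ?_ ?_) (le_refl _))
              (le_iSup_of_le (⟨j - 1, by omega⟩ : Fin (i + 1)) ?_)
            · omega
            · omega
            · have : i + 1 + 1 - (j : ℕ) = i + 1 - (j - 1) := by omega
              simp [this]
  have anti : Antitone Z := antitone_nat_of_succ_le step
  refine ⟨h0, h1, anti, ?_, ?_⟩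
  · intro i j x y hx hy
    have comm : ∀ i j, ∀ x ∈ Z (i + 1), ∀ y ∈ Z (j + 1), ⁅x, y⁆ ∈ Z (i + 1 + (j + 1)) := by
      intro i j x hx y hy
      have e : i + 1 + (j + 1) = i + j + 2 := by ring
      rw [e, hZ]
      refine hle _ (Subgroup.mem_sup_right
        (Subgroup.mem_iSup_of_mem (⟨i, by omega⟩ : Fin (i + j + 1))
          (Subgroup.commutator_mem_commutator hx ?_)))
      have : i + j + 1 - i = j + 1 := by omega
      simpa [this] using hy
    match i, j, hx, hy with
    | i + 1, j + 1, hx, hy => exact comm i j x hx y hy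
    | 0, 0, _, _ => simp [h0]
    | 0, j + 1, _, hy =>
      exact anti (by omega) (comm 0 j x (by simp [h1]) y hy)
    | i + 1, 0, hx, _ =>
      exact anti (by omega) (comm i 0 x hx y (by simp [h1]))
  · intro i x hx
    rcases Nat.eq_zero_or_pos i with rfl | hi
    · simp [h0]
    · obtain ⟨k, hk⟩ : ∃ k, p * i = k + 2 := ⟨p * i - 2, by
        have : 2 * 1 ≤ p * i := Nat.mul_le_mul hp2 hi
        omega⟩
      rw [hk, hZ, ← hk]
      refine hle _ (Subgroup.mem_sup_left (pow_mem_powSubgroup p ?_))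
      have : (p * i) ⌈/⌉ p = i := by
        simpa using smul_ceilDiv (α := ℕ) (β := ℕ) hp.out.pos i
      rwa [this]

theorem zassenhaus_isNpSeries : IsNpSeries p (zassenhaus G p) :=
  isNpSeries_of_rec p id monotone_id (fun _ => le_rfl) (by rw [zassenhaus]) (by rw [zassenhaus])
    fun i => by rw [zassenhaus]; rfl

theorem closedZassenhaus_isNpSeries [TopologicalSpace G] [IsTopologicalGroup G] :
    IsNpSeries p (closedZassenhaus G p) :=
  isNpSeries_of_rec p Subgroup.topologicalClosure
    (fun _ _ h => Subgroup.topologicalClosure_mono h) Subgroup.le_topologicalClosure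
    (by rw [closedZassenhaus]) (by rw [closedZassenhaus]) fun i => by rw [closedZassenhaus]

/-- The Zassenhaus filtration is the smallest series compatible with commutators and `p`-th
powers. -/
theorem IsNpSeries.zassenhaus_le {Z : ℕ → Subgroup G} (h : IsNpSeries p Z) (n : ℕ) :
    zassenhaus G p n ≤ Z n := by
  induction n using Nat.strong_induction_on with
  | _ n ih =>
    match n with
    | 0 => simp [h.zero]
    | 1 => simp [h.one]
    | i + 2 =>
      rw [zassenhaus]
      refine sup_le ((powSubgroup_le p).2 fun x hx => ?_) (iSup_le fun j =>
        Subgroup.commutator_le.2 fun x hx y hy => ?_)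
      · refine h.antitone ?_ (h.pow_mem (ih _ (ceilDiv_lt p i) hx))
        exact (ceilDiv_le_iff_le_mul hp.out.pos).1 le_rfl
      · have := h.commutator (ih _ (by omega) hx) (ih _ (by omega) hy)
        rwa [show (j : ℕ) + 1 + (i + 1 - j) = i + 2 by omega] at this

theorem IsNpSeries.closedZassenhaus_le [TopologicalSpace G] [IsTopologicalGroup G]
    {Z : ℕ → Subgroup G} (h : IsNpSeries p Z) (hcl : ∀ i, IsClosed (Z i : Set G)) (n : ℕ) :
    closedZassenhaus G p n ≤ Z n := by
  induction n using Nat.strong_induction_on with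
  | _ n ih =>
    match n with
    | 0 => simp [h.zero]
    | 1 => simp [h.one]
    | i + 2 =>
      rw [closedZassenhaus]
      refine Subgroup.topologicalClosure_minimal _ (sup_le ((powSubgroup_le p).2 fun x hx => ?_)
        (iSup_le fun j => Subgroup.commutator_le.2 fun x hx y hy => ?_)) (hcl _)
      · refine h.antitone ?_ (h.pow_mem (ih _ (ceilDiv_lt p i) hx))
        exact (ceilDiv_le_iff_le_mul hp.out.pos).1 le_rfl
      · have := h.commutator (ih _ (by omega) hx) (ih _ (by omega) hy)
        rwa [show (j : ℕ) + 1 + (i + 1 - j) = i + 2 by omega] at this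

theorem isClosed_closedZassenhaus [TopologicalSpace G] [IsTopologicalGroup G] (n : ℕ) :
    IsClosed (closedZassenhaus G p n : Set G) := by
  match n with
  | 0 => rw [closedZassenhaus]; exact isClosed_univ
  | 1 => rw [closedZassenhaus]; exact isClosed_univ
  | i + 2 => rw [closedZassenhaus]; exact Subgroup.isClosed_topologicalClosure _

end Basics

/-! ### Dimension subgroups of filtered rings -/

section Dimension

variable {G : Type u} [Group G] (p : ℕ) [hp : Fact p.Prime] {A : Type v} [Ring A]

/-- A multiplicative descending filtration of a ring. -/
structure IsMulFiltration (F : ℕ → AddSubgroup A) : Prop where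
  antitone : Antitone F
  mul_mem : ∀ {i j a b}, a ∈ F i → b ∈ F j → a * b ∈ F (i + j)

/-- The dimension subgroups `{g | θ g - 1 ∈ F i}` for a representation `θ` of a group in a filtered
ring. -/
def dimensionSubgroup {F : ℕ → AddSubgroup A} (hF : IsMulFiltration F) (θ : G →* A)
    (hθ : ∀ g, θ g - 1 ∈ F 1) (i : ℕ) : Subgroup G where
  carrier := {g | θ g - 1 ∈ F i}
  one_mem' := by simp
  mul_mem' := by
    intro a b (ha : _ ∈ _) (hb : _ ∈ _)
    have h1 : (θ a - 1) * (θ b - 1) ∈ F i :=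
      hF.antitone (Nat.le_add_right _ _) (hF.mul_mem ha (hθ b))
    have : θ (a * b) - 1 = (θ a - 1) * (θ b - 1) + (θ a - 1) + (θ b - 1) := by
      rw [map_mul]; noncomm_ring
    show θ (a * b) - 1 ∈ F i
    rw [this]
    exact add_mem (add_mem h1 ha) hb
  inv_mem' := by
    intro a (ha : _ ∈ _)
    have h1 : (θ a⁻¹ - 1) * (θ a - 1) ∈ F i :=
      hF.antitone (Nat.le_add_left _ _) (hF.mul_mem (hθ a⁻¹) ha)
    have h2 : θ a⁻¹ * θ a = 1 := by rw [← map_mul]; simp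
    have : θ a⁻¹ - 1 = -((θ a⁻¹ - 1) * (θ a - 1)) - (θ a - 1) := by
      simp only [sub_mul, mul_sub, h2]; noncomm_ring
    show θ a⁻¹ - 1 ∈ F i
    rw [this]
    exact sub_mem (neg_mem h1) ha

theorem map_commutator_sub_one (θ : G →* A) (x y : G) :
    θ x * θ y - θ y * θ x = (θ ⁅x, y⁆ - 1) * (θ y * θ x) := by
  rw [sub_mul, one_mul, ← map_mul, ← map_mul, ← map_mul, commutatorElement_def]
  congr 2
  group

theorem pow_mem_filtration {F : ℕ → AddSubgroup A} (hF : IsMulFiltration F) {i : ℕ} {a : A}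
    (ha : a ∈ F i) {k : ℕ} (hk : 0 < k) : a ^ k ∈ F (k * i) := by
  induction k, hk using Nat.le_induction with
  | base => simpa using ha
  | succ k hk ih => rw [pow_succ, add_mul, one_mul]; exact hF.mul_mem ih ha

/-- The ring commutator of `θ x - 1` and `θ y - 1` differs from `θ ⁅x, y⁆ - 1` by a unit factor, and
in characteristic `p` one has `θ (x ^ p) - 1 = (θ x - 1) ^ p`. -/
theorem dimensionSubgroup_isNpSeries [CharP A p] {F : ℕ → AddSubgroup A} (hF : IsMulFiltration F)
    (θ : G →* A) (hθ : ∀ g, θ g - 1 ∈ F 1) : IsNpSeries p (dimensionSubgroup hF θ hθ) where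
  zero := eq_top_iff.2 fun g _ => hF.antitone (Nat.zero_le 1) (hθ g)
  one := eq_top_iff.2 fun g _ => hθ g
  antitone _ _ hij _ hg := hF.antitone hij hg
  commutator := by
    intro i j x y (hx : _ ∈ _) (hy : _ ∈ _)
    have key : θ x * θ y - θ y * θ x ∈ F (i + j) := by
      have : θ x * θ y - θ y * θ x =
          (θ x - 1) * (θ y - 1) - (θ y - 1) * (θ x - 1) := by noncomm_ring
      rw [this]
      exact sub_mem (hF.mul_mem hx hy) (add_comm j i ▸ hF.mul_mem hy hx)
    -- The unit is split as `1 + (u - 1)` because units are not assumed to lie in `F 0`, while `u -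
    -- 1 ∈ F 1` is known.
    have h2 : θ ⁅x, y⁆ - 1 = (θ x * θ y - θ y * θ x) +
        (θ x * θ y - θ y * θ x) * (θ (x⁻¹ * y⁻¹) - 1) := by
      have : θ y * θ x * θ (x⁻¹ * y⁻¹) = 1 := by
        rw [← map_mul, ← map_mul]; convert map_one θ using 2; group
      rw [map_commutator_sub_one, mul_sub, mul_one, mul_assoc _ _ (θ (x⁻¹ * y⁻¹)), this]
      noncomm_ring
    show θ ⁅x, y⁆ - 1 ∈ F (i + j)
    rw [h2]
    exact add_mem key (hF.antitone (Nat.le_add_right _ 1) (hF.mul_mem key (hθ _)))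
  pow_mem := by
    intro i x (hx : _ ∈ _)
    show θ (x ^ p) - 1 ∈ F (p * i)
    have : θ (x ^ p) - 1 = (θ x - 1) ^ p := by
      rw [sub_pow_char_of_commute p (Commute.one_right _), map_pow, one_pow]
    rw [this]
    exact pow_mem_filtration hF hx hp.out.pos

end Dimension

/-! ### Powers of the augmentation ideal and their nilpotence for finite `p`-groups -/

section Augmentation

variable {G : Type u} [Group G] {p : ℕ} [hp : Fact p.Prime] {A : Type v} [Ring A]
  [Algebra (ZMod p) A] (θ : G →* A)

/-- The span of the elements `θ g - 1`. -/
def augmentation : Submodule (ZMod p) A := Submodule.span (ZMod p) (Set.range fun g => θ g - 1)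

/-- The powers of the augmentation ideal of the image of a group algebra; the zeroth power is the
whole algebra. -/
def augPow : ℕ → Submodule (ZMod p) A
  | 0 => ⊤
  | i + 1 => augPow i * augmentation θ

variable {θ}

theorem sub_one_mem_augmentation (g : G) : θ g - 1 ∈ augmentation (p := p) θ :=
  Submodule.subset_span ⟨g, rfl⟩

variable (hθ : Submodule.span (ZMod p) (Set.range θ) = ⊤)

include hθ

theorem augmentation_mul_top : augmentation (p := p) θ * ⊤ ≤ augmentation θ := by
  rw [← hθ, augmentation, Submodule.span_mul_span, Submodule.span_le]
  rintro _ ⟨_, ⟨g, rfl⟩, _, ⟨h, rfl⟩, rfl⟩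
  have : (θ g - 1) * θ h = (θ (g * h) - 1) - (θ h - 1) := by rw [map_mul]; noncomm_ring
  simp only [this]
  exact sub_mem (sub_one_mem_augmentation _) (sub_one_mem_augmentation _)

theorem augPow_mul_top (i : ℕ) : augPow (p := p) θ i * ⊤ ≤ augPow θ i := by
  cases i with
  | zero => exact le_top
  | succ i => rw [augPow, mul_assoc]; exact mul_le_mul_right (augmentation_mul_top hθ) _

theorem augPow_mul_augPow (i j : ℕ) :
    augPow (p := p) θ i * augPow θ j ≤ augPow θ (i + j) := by
  induction j with
  | zero => exact augPow_mul_top hθ i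
  | succ j ih =>
    rw [← add_assoc, augPow, augPow, ← mul_assoc]
    exact mul_le_mul_left ih _

theorem augPow_antitone : Antitone (augPow (p := p) θ) :=
  antitone_nat_of_succ_le fun i =>
    (mul_le_mul_right le_top _).trans (augPow_mul_top hθ i)

omit hθ in
theorem sub_one_mem_augPow_one (g : G) : θ g - 1 ∈ augPow (p := p) θ 1 := by
  rw [augPow, augPow]
  simpa using Submodule.mul_mem_mul (Submodule.mem_top (x := (1 : A)))
    (sub_one_mem_augmentation (p := p) (θ := θ) g)

theorem augPow_isMulFiltration :
    IsMulFiltration fun i => (augPow (p := p) θ i).toAddSubgroup where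
  antitone _ _ h := augPow_antitone hθ h
  mul_mem ha hb := augPow_mul_augPow hθ _ _ (Submodule.mul_mem_mul ha hb)

omit hθ in
/-- A subspace `W` of a finite algebra with `W * I = W`, where `I` is the augmentation ideal of a
`p`-group, vanishes: otherwise the dual of `W` has a nonzero vector fixed by the group. -/
theorem eq_bot_of_mul_augmentation_eq [Finite A] (hG : IsPGroup p G) {W : Submodule (ZMod p) A}
    (hW : W * augmentation θ = W) : W = ⊥ := by
  by_contra hne
  have hmul : ∀ g, ∀ w ∈ W, LinearMap.mulRight (ZMod p) (θ g) w ∈ W := by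
    intro g w hw
    have h1 : w * (θ g - 1) ∈ W := by
      rw [← hW]
      exact Submodule.mul_mem_mul hw (sub_one_mem_augmentation g)
    have : LinearMap.mulRight (ZMod p) (θ g) w = w * (θ g - 1) + w := by
      simp [mul_sub]
    rw [this]
    exact add_mem h1 hw
  let R (g : G) : W →ₗ[ZMod p] W := (LinearMap.mulRight (ZMod p) (θ g)).restrict (hmul g)
  have hR : ∀ g (w : W), (R g w : A) = w * θ g := fun g w => rfl
  let _ : MulAction G (Module.Dual (ZMod p) W) :=
    { smul := fun g l => l.comp (R g)
      one_smul := fun l => by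
        refine LinearMap.ext fun w => congrArg l (Subtype.ext ?_)
        simp [hR]
      mul_smul := fun g h l => by
        refine LinearMap.ext fun w => congrArg l (Subtype.ext ?_)
        simp [hR, mul_assoc] }
  have hsmul : ∀ (g : G) (l : Module.Dual (ZMod p) W) (w : W), (g • l) w = l (R g w) :=
    fun _ _ _ => rfl
  have : Nontrivial W := Submodule.nontrivial_iff_ne_bot.2 hne
  have : Finite (Module.Dual (ZMod p) W) := Module.finite_of_finite (ZMod p)
  have hdvd : p ∣ Nat.card (Module.Dual (ZMod p) W) := by
    rw [Module.natCard_eq_pow_finrank (K := ZMod p), Nat.card_zmod]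
    exact dvd_pow_self p (Module.finrank_pos).ne'
  obtain ⟨l, hl, hl0⟩ := hG.exists_fixed_point_of_prime_dvd_card_of_fixed_point _ hdvd
    (a := (0 : Module.Dual (ZMod p) W)) fun g => by
      refine LinearMap.ext fun w => ?_
      rw [hsmul]; simp
  refine hl0 (LinearMap.ext fun w => ?_)
  -- An invariant functional `l` kills every `a * (θ g - 1)`, hence all of `W * I`, which is `W`;
  -- this contradicts `l ≠ 0`.
  suffices H : W ≤ (LinearMap.ker l).map W.subtype by
    obtain ⟨v, hv, hvw⟩ := H w.2
    have : v = w := Subtype.ext hvw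
    simpa [this] using (LinearMap.mem_ker.1 hv).symm
  conv_lhs => rw [← hW]
  rw [Submodule.mul_le]
  intro a ha b hb
  induction hb using Submodule.span_induction with
  | mem b hb =>
    obtain ⟨g, rfl⟩ := hb
    refine ⟨R g ⟨a, ha⟩ - ⟨a, ha⟩, ?_, by simp [hR, mul_sub]⟩
    have := congrArg (fun k : Module.Dual (ZMod p) W => k ⟨a, ha⟩) (hl g)
    simp only [hsmul] at this
    simp [this]
  | zero => simp
  | add b c _ _ hb hc => rw [mul_add]; exact add_mem hb hc
  | smul r b _ hb => rw [mul_smul_comm]; exact Submodule.smul_mem _ _ hb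

theorem exists_augPow_eq_bot [Finite A] (hG : IsPGroup p G) : ∃ m, augPow (p := p) θ m = ⊥ := by
  obtain ⟨m, hm⟩ := WellFoundedLT.antitone_chain_condition (augPow_antitone (p := p) hθ)
  exact ⟨m, eq_bot_of_mul_augmentation_eq hG (hm (m + 1) (Nat.le_succ m)).symm⟩

end Augmentation

/-! ### Weighted generators of a finite `p`-group -/

section Generators

variable {G : Type u} [Group G] {p : ℕ} [hp : Fact p.Prime]

theorem mul_card_le_of_lt [Finite G] (hG : IsPGroup p G) {K L : Subgroup G} (h : K < L) :
    p * Nat.card K ≤ Nat.card L := by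
  obtain ⟨a, ha⟩ := (IsPGroup.iff_card.1 (hG.to_subgroup K))
  obtain ⟨b, hb⟩ := (IsPGroup.iff_card.1 (hG.to_subgroup L))
  have hlt : Nat.card K < Nat.card L := Set.Finite.card_lt_card (Set.toFinite _) h
  rw [ha, hb] at hlt ⊢
  rw [← pow_succ']
  exact Nat.pow_le_pow_right hp.out.pos ((Nat.pow_lt_pow_iff_right hp.out.one_lt).1 hlt)

/-- Each new generator enlarges the subgroup by a factor of at least `p`, which pays for one more
factor `p` in the length bound. -/
theorem generators_cons [Finite G] (hG : IsPGroup p G) {K L : Subgroup G} {g : G}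
    (hgL : g ∈ L) (hgK : g ∉ K) {xs : List G} (h1 : ∀ x ∈ xs, x ∈ L)
    (h2 : L ≤ Subgroup.closure ({x | x ∈ xs} ∪ (K ⊔ Subgroup.closure {g} : Subgroup G)))
    (h3 : p ^ xs.length * Nat.card (K ⊔ Subgroup.closure {g} : Subgroup G) ≤ Nat.card L) :
    (∀ x ∈ g :: xs, x ∈ L) ∧ L ≤ Subgroup.closure ({x | x ∈ g :: xs} ∪ (K : Set G)) ∧
      p ^ (g :: xs).length * Nat.card K ≤ Nat.card L := by
  have hK : K < K ⊔ Subgroup.closure {g} :=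
    lt_of_le_of_ne le_sup_left fun h => hgK (h ▸ Subgroup.mem_sup_right
      (Subgroup.subset_closure rfl))
  refine ⟨by simpa [hgL] using h1, h2.trans ?_, ?_⟩
  · rw [Subgroup.closure_le]
    rintro y (hy | hy)
    · exact Subgroup.subset_closure (Or.inl (List.mem_cons_of_mem _ hy))
    · have : K ⊔ Subgroup.closure {g} ≤ Subgroup.closure ({y | y ∈ g :: xs} ∪ (K : Set G)) := by
        refine sup_le (fun z hz => Subgroup.subset_closure (Or.inr hz)) ?_
        rw [Subgroup.closure_le]
        rintro _ rfl
        exact Subgroup.subset_closure (Or.inl (by simp))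
      exact this hy
  · calc p ^ (g :: xs).length * Nat.card K = p ^ xs.length * (p * Nat.card K) := by
          rw [List.length_cons, pow_succ, mul_assoc]
      _ ≤ p ^ xs.length * Nat.card (K ⊔ Subgroup.closure {g} : Subgroup G) :=
          Nat.mul_le_mul_left _ (mul_card_le_of_lt hG hK)
      _ ≤ _ := h3

/-- In a finite `p`-group, `L` is generated over a subgroup `K` by at most `log_p [L : K]`
elements. -/
theorem exists_generators [Finite G] (hG : IsPGroup p G) {L : Subgroup G} (K : Subgroup G)
    (hKL : K ≤ L) : ∃ xs : List G, (∀ x ∈ xs, x ∈ L) ∧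
      L ≤ Subgroup.closure ({x | x ∈ xs} ∪ (K : Set G)) ∧
      p ^ xs.length * Nat.card K ≤ Nat.card L := by
  induction K using WellFoundedGT.induction with
  | _ K ih =>
    rcases hKL.eq_or_lt with rfl | hlt
    · exact ⟨[], by simp, by simp, by simp⟩
    · obtain ⟨x, hxL, hxK⟩ := SetLike.exists_of_lt hlt
      have hK : K < K ⊔ Subgroup.closure {x} :=
        lt_of_le_of_ne le_sup_left fun h => hxK (h ▸ Subgroup.mem_sup_right
          (Subgroup.subset_closure rfl))
      obtain ⟨xs, h1, h2, h3⟩ := ih _ hK (sup_le hKL (by simpa using hxL))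
      exact ⟨x :: xs, generators_cons hG hxL hxK h1 h2 h3⟩

theorem exists_generators_cons [Finite G] (hG : IsPGroup p G) {K L : Subgroup G} (hKL : K ≤ L)
    {g : G} (hgL : g ∈ L) (hgK : g ∉ K) : ∃ xs : List G, g ∈ xs ∧ (∀ x ∈ xs, x ∈ L) ∧
      L ≤ Subgroup.closure ({x | x ∈ xs} ∪ (K : Set G)) ∧
      p ^ xs.length * Nat.card K ≤ Nat.card L := by
  obtain ⟨xs, h1, h2, h3⟩ := exists_generators hG (L := L) (K ⊔ Subgroup.closure {g})
    (sup_le hKL ((Subgroup.closure_le _).2 (by simpa using hgL)))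
  exact ⟨g :: xs, by simp, generators_cons hG hgL hgK h1 h2 h3⟩

/-- Weighted generators adapted to a series, containing a prescribed element. -/
theorem exists_weighted_generators [Finite G] {Z : ℕ → Subgroup G} (hZ : IsNpSeries p Z) {n : ℕ}
    (hn : Z n = ⊥) {m : ℕ} (hm : 1 ≤ m) {g : G} (hg : g ∈ Z m) (hg' : g ∉ Z (m + 1)) :
    ∃ xs : List (G × ℕ), (g, m) ∈ xs ∧ (∀ x ∈ xs, 1 ≤ x.2 ∧ x.1 ∈ Z x.2) ∧
      (∀ i, 1 ≤ i → Z i ≤ Subgroup.closure ({x | (x, i) ∈ xs} ∪ (Z (i + 1) : Set G))) ∧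
      p ^ xs.length ≤ Nat.card G := by
  have hG := hZ.isPGroup p hn
  have hbot : ∀ i, n ≤ i → Z i = ⊥ := fun i hi => le_bot_iff.1 (hn ▸ hZ.antitone hi)
  -- The list is built upwards from the trivial end of the series, one level at a time; `g` enters
  -- at level `m`.
  suffices H : ∀ k j, 1 ≤ j → n ≤ j + k → ∃ xs : List (G × ℕ), (j ≤ m → (g, m) ∈ xs) ∧
      (∀ x ∈ xs, 1 ≤ x.2 ∧ x.1 ∈ Z x.2) ∧
      (∀ i, j ≤ i → Z i ≤ Subgroup.closure ({x | (x, i) ∈ xs} ∪ (Z (i + 1) : Set G))) ∧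
      p ^ xs.length ≤ Nat.card (Z j) by
    obtain ⟨xs, h1, h2, h3, h4⟩ := H n 1 le_rfl (by omega)
    refine ⟨xs, h1 hm, h2, h3, h4.trans (Subgroup.card_le_card_group _)⟩
  intro k
  induction k with
  | zero =>
    intro j _ hj
    refine ⟨[], fun hjm => ?_, by simp, fun i hi => by simp [hbot i (by omega)],
      by simp only [List.length_nil, pow_zero]; exact Nat.card_pos⟩
    have : g ∈ Z (m + 1) := by
      rw [hbot m (by omega)] at hg
      rw [Subgroup.mem_bot.1 hg]
      exact one_mem _
    exact absurd this hg'
  | succ k ih =>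
    intro j hj1 hj
    obtain ⟨xs, h1, h2, h3, h4⟩ := ih (j + 1) (by omega) (by omega)
    have hle : Z (j + 1) ≤ Z j := hZ.antitone (Nat.le_succ j)
    obtain ⟨ys, k0, k1, k2, k3⟩ : ∃ ys : List G, (j = m → g ∈ ys) ∧ (∀ x ∈ ys, x ∈ Z j) ∧
        Z j ≤ Subgroup.closure ({x | x ∈ ys} ∪ (Z (j + 1) : Set G)) ∧
        p ^ ys.length * Nat.card (Z (j + 1)) ≤ Nat.card (Z j) := by
      by_cases hjm : j = m
      · subst hjm
        obtain ⟨ys, hy, h⟩ := exists_generators_cons hG hle hg hg'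
        exact ⟨ys, fun _ => hy, h⟩
      · obtain ⟨ys, h⟩ := exists_generators hG _ hle
        exact ⟨ys, fun h => absurd h hjm, h⟩
    refine ⟨ys.map (fun y => (y, j)) ++ xs, fun hjm => ?_, ?_, fun i hi => ?_, ?_⟩
    · rcases hjm.eq_or_lt with h | h
      · exact List.mem_append_left _ (List.mem_map.2 ⟨g, k0 h, by rw [h]⟩)
      · exact List.mem_append_right _ (h1 h)
    · intro x hx
      rcases List.mem_append.1 hx with hx | hx
      · obtain ⟨y, hy, rfl⟩ := List.mem_map.1 hx
        exact ⟨hj1, k1 y hy⟩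
      · exact h2 x hx
    · rcases hi.eq_or_lt with rfl | h
      · refine k2.trans (Subgroup.closure_mono (Set.union_subset_union_left _ fun y hy => ?_))
        exact List.mem_append_left _ (List.mem_map.2 ⟨y, hy, rfl⟩)
      · refine (h3 i h).trans
          (Subgroup.closure_mono (Set.union_subset_union_left _ fun y hy => ?_))
        exact List.mem_append_right _ hy
    · rw [List.length_append, List.length_map, pow_add]
      exact (Nat.mul_le_mul_left _ h4).trans k3

end Generators

/-! ### Straightening products into ordered monomials -/

section Straightening

variable {G : Type u} [Group G] {p : ℕ} {A : Type v} [Ring A] [Algebra (ZMod p) A] (θ : G →* A)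
  {N : ℕ} (x : Fin N → G) (w : Fin N → ℕ)

/-- The product of the elements `θ (x i) - 1` along a list of indices. -/
def listProd (l : List (Fin N)) : A := (l.map fun i => θ (x i) - 1).prod

/-- The total weight of a list of indices. -/
def listWeight (l : List (Fin N)) : ℕ := (l.map w).sum

/-- The span, modulo higher powers of the augmentation ideal, of the products of weight `e` with
fewer than `k` factors. -/
def shortSpan [Fact p.Prime] (e k : ℕ) : Submodule (ZMod p) A :=
  Submodule.span (ZMod p) (listProd θ x '' {l | listWeight w l = e ∧ l.length < k}) ⊔
    augPow θ (e + 1)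

/-- The ordered list in which the index `i` occurs `a i` times. -/
def orderedList (a : Fin N → ℕ) : List (Fin N) :=
  (List.ofFn fun i => List.replicate (a i) i).flatten

/-- The span of the ordered monomials with exponents below `p` and weight at least `d`. -/
def reducedSpan (d : ℕ) : Submodule (ZMod p) A :=
  Submodule.span (ZMod p) ((fun a : Fin N → Fin p => listProd θ x (orderedList fun i => a i)) ''
    {a | d ≤ listWeight w (orderedList fun i => a i)})

variable {θ x w}

theorem listProd_cons (i : Fin N) (l : List (Fin N)) :
    listProd θ x (i :: l) = (θ (x i) - 1) * listProd θ x l := by simp [listProd]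

theorem listProd_append (l m : List (Fin N)) :
    listProd θ x (l ++ m) = listProd θ x l * listProd θ x m := by simp [listProd]

theorem listProd_replicate (k : ℕ) (i : Fin N) :
    listProd θ x (List.replicate k i) = (θ (x i) - 1) ^ k := by simp [listProd]

theorem listWeight_cons (i : Fin N) (l : List (Fin N)) :
    listWeight w (i :: l) = w i + listWeight w l := by simp [listWeight]

theorem listWeight_append (l m : List (Fin N)) :
    listWeight w (l ++ m) = listWeight w l + listWeight w m := by simp [listWeight]

theorem listWeight_replicate (k : ℕ) (i : Fin N) :
    listWeight w (List.replicate k i) = k * w i := by simp [listWeight]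

theorem listWeight_perm {l m : List (Fin N)} (h : l.Perm m) : listWeight w l = listWeight w m :=
  (h.map w).sum_eq

theorem count_orderedList (a : Fin N → ℕ) (i : Fin N) : (orderedList a).count i = a i := by
  rw [orderedList, List.count_flatten, List.map_ofFn, List.sum_ofFn]
  simp [List.count_replicate]

theorem orderedList_perm {l : List (Fin N)} : (orderedList fun i => l.count i).Perm l :=
  List.perm_iff_count.2 fun i => count_orderedList _ i

theorem orderedList_single (i : Fin N) : orderedList (fun j => if j = i then 1 else 0) = [i] := by
  refine List.perm_singleton.1 (List.perm_iff_count.2 fun j => ?_)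
  rw [count_orderedList]
  by_cases h : j = i
  · simp [h]
  · simp [h, Ne.symm h]

theorem reducedSpan_antitone : Antitone (reducedSpan (p := p) θ x w) := fun _ _ h =>
  Submodule.span_mono (Set.image_mono fun _ ha => le_trans h ha)

variable [hp : Fact p.Prime]

theorem listProd_mem_shortSpan {e k : ℕ} {l : List (Fin N)} (he : listWeight w l = e)
    (hk : l.length < k) : listProd θ x l ∈ shortSpan (p := p) θ x w e k :=
  Submodule.mem_sup_left (Submodule.subset_span ⟨l, ⟨he, hk⟩, rfl⟩)

theorem mul_mem_augPow (hθ : Submodule.span (ZMod p) (Set.range θ) = ⊤) {i j k : ℕ} {a b : A}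
    (ha : a ∈ augPow (p := p) θ i) (hb : b ∈ augPow (p := p) θ j) (hk : k ≤ i + j) :
    a * b ∈ augPow (p := p) θ k :=
  augPow_antitone hθ hk (augPow_mul_augPow hθ i j (Submodule.mul_mem_mul ha hb))

variable (hθ : Submodule.span (ZMod p) (Set.range θ) = ⊤)
  {Z : ℕ → Subgroup G} (hZ : IsNpSeries p Z)
  (hZθ : ∀ i, ∀ g ∈ Z i, θ g - 1 ∈ augPow (p := p) θ i)
  (hx : ∀ i, 1 ≤ w i ∧ x i ∈ Z (w i))
  (hgen : ∀ j, 1 ≤ j → Z j ≤ Subgroup.closure ({g | ∃ i, w i = j ∧ x i = g} ∪ (Z (j + 1) : Set G)))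

include hθ hZθ hx in
theorem listProd_mem_augPow (l : List (Fin N)) :
    listProd θ x l ∈ augPow (p := p) θ (listWeight w l) := by
  induction l with
  | nil => exact Submodule.mem_top
  | cons i l ih =>
    rw [listProd_cons, listWeight_cons]
    exact mul_mem_augPow hθ (hZθ _ _ (hx i).2) ih le_rfl

include hθ hZ hZθ hx hgen in
/-- Modulo the next power of the augmentation ideal, `g - 1` is a linear combination of the
`x i - 1` whose weight is the level of `g`. -/
theorem sub_one_mem_span_sup {j : ℕ} (hj : 1 ≤ j) {g : G} (hg : g ∈ Z j) :
    θ g - 1 ∈ Submodule.span (ZMod p) ((fun i => θ (x i) - 1) '' {i | w i = j}) ⊔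
      augPow (p := p) θ (j + 1) := by
  set V := Submodule.span (ZMod p) ((fun i => θ (x i) - 1) '' {i | w i = j}) ⊔
      augPow (p := p) θ (j + 1) with hV
  have hVle : V ≤ augPow θ j := by
    refine sup_le (Submodule.span_le.2 ?_) (augPow_antitone hθ (Nat.le_succ j))
    rintro _ ⟨i, rfl, rfl⟩
    exact hZθ _ _ (hx i).2
  have hmul : ∀ (h : G) a, a ∈ V → (θ h - 1) * a ∈ V := fun h a ha =>
    Submodule.mem_sup_right (mul_mem_augPow hθ (sub_one_mem_augPow_one h) (hVle ha) (by omega))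
  have hcl := hgen j hj hg
  induction hcl using Subgroup.closure_induction with
  | mem a ha =>
    rcases ha with ⟨i, hi, rfl⟩ | ha
    · exact Submodule.mem_sup_left (Submodule.subset_span ⟨i, hi, rfl⟩)
    · exact Submodule.mem_sup_right (hZθ _ _ ha)
  | one => simp
  | mul a b ha hb iha ihb =>
    have hcl : ∀ g ∈ Subgroup.closure ({g | ∃ i, w i = j ∧ x i = g} ∪ (Z (j + 1) : Set G)),
        g ∈ Z j := by
      rw [← SetLike.le_def, Subgroup.closure_le]
      rintro _ (⟨i, rfl, rfl⟩ | h)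
      · exact (hx i).2
      · exact hZ.antitone (Nat.le_succ j) h
    have e : θ (a * b) - 1 = (θ a - 1) * (θ b - 1) + (θ a - 1) + (θ b - 1) := by
      rw [map_mul]; noncomm_ring
    rw [e]
    have h1 := iha (hcl a ha)
    have h2 := ihb (hcl b hb)
    exact add_mem (add_mem (hmul _ _ h2) h1) h2
  | inv a ha iha =>
    have h1 := iha (by simpa using hg)
    have h2 : θ a⁻¹ * θ a = 1 := by rw [← map_mul]; simp
    have : θ a⁻¹ - 1 = -((θ a⁻¹ - 1) * (θ a - 1)) - (θ a - 1) := by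
      simp only [sub_mul, mul_sub, h2]; noncomm_ring
    rw [this]
    exact sub_mem (neg_mem (hmul _ _ h1)) h1

include hθ hZ hZθ hx hgen in
-- An element of `Z j` costs only one factor of weight `j`. This is why the corrections from
-- commutators and `p`-th powers are shorter products of the same weight.
theorem sub_one_mul_listProd_mem {j : ℕ} (hj : 1 ≤ j) {g : G} (hg : g ∈ Z j)
    (l : List (Fin N)) {k : ℕ} (hk : l.length + 1 < k) :
    (θ g - 1) * listProd θ x l ∈ shortSpan (p := p) θ x w (j + listWeight w l) k := by
  obtain ⟨a, ha, b, hb, hab⟩ := Submodule.mem_sup.1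
    (sub_one_mem_span_sup hθ hZ hZθ hx hgen hj hg)
  rw [← hab, add_mul]
  refine add_mem ?_ (Submodule.mem_sup_right
    (mul_mem_augPow hθ hb (listProd_mem_augPow hθ hZθ hx l) (by omega)))
  clear hab
  induction ha using Submodule.span_induction with
  | mem a ha =>
    obtain ⟨i, rfl, rfl⟩ := ha
    rw [← listProd_cons]
    exact listProd_mem_shortSpan (listWeight_cons i l) hk
  | zero => simp
  | add a b _ _ iha ihb => rw [add_mul]; exact add_mem iha ihb
  | smul r a _ iha => rw [smul_mul_assoc]; exact Submodule.smul_mem _ _ iha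

include hθ hZθ hx in
theorem sub_one_mul_mem_shortSpan (i : Fin N) {e k : ℕ} {a : A}
    (ha : a ∈ shortSpan (p := p) θ x w e k) :
    (θ (x i) - 1) * a ∈ shortSpan (p := p) θ x w (w i + e) (k + 1) := by
  obtain ⟨b, hb, c, hc, rfl⟩ := Submodule.mem_sup.1 ha
  rw [mul_add]
  refine add_mem ?_ (Submodule.mem_sup_right (mul_mem_augPow hθ (hZθ _ _ (hx i).2) hc le_rfl))
  clear ha
  induction hb using Submodule.span_induction with
  | mem a ha =>
    obtain ⟨l, ⟨rfl, hl⟩, rfl⟩ := ha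
    rw [← listProd_cons]
    exact listProd_mem_shortSpan (listWeight_cons i l) (by simpa using hl)
  | zero => simp
  | add a b _ _ iha ihb => rw [mul_add]; exact add_mem iha ihb
  | smul r a _ iha => rw [mul_smul_comm]; exact Submodule.smul_mem _ _ iha

include hθ hZ hZθ hx hgen in
/-- Permuting the factors changes a product only by shorter products of the same weight. -/
theorem listProd_sub_mem_of_perm {l m : List (Fin N)} (h : l.Perm m) :
    listProd θ x l - listProd θ x m ∈ shortSpan (p := p) θ x w (listWeight w l) l.length := by
  induction h with
  | nil => simp
  | cons i h ih =>
    rw [listProd_cons, listProd_cons, ← mul_sub, listWeight_cons]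
    exact sub_one_mul_mem_shortSpan hθ hZθ hx i ih
  -- The difference is `θ ⁅x j, x i⁆ - 1` times a unit times the remaining product. The commutator
  -- replaces two factors by one of the same total weight, and the part of the unit beyond `1`
  -- raises the degree.
  | swap i j l =>
    have hc : ⁅x j, x i⁆ ∈ Z (w j + w i) := hZ.commutator (hx j).2 (hx i).2
    have hcomm := map_commutator_sub_one θ (x j) (x i)
    have e : listProd θ x (j :: i :: l) - listProd θ x (i :: j :: l) =
        (θ ⁅x j, x i⁆ - 1) * listProd θ x l +
          ((θ ⁅x j, x i⁆ - 1) * (θ (x i * x j) - 1)) * listProd θ x l := by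
      have : listProd θ x (j :: i :: l) - listProd θ x (i :: j :: l) =
          (θ (x j) * θ (x i) - θ (x i) * θ (x j)) * listProd θ x l := by
        simp only [listProd_cons]; noncomm_ring
      rw [this, hcomm, map_mul]; noncomm_ring
    rw [e]
    have ew : listWeight w (j :: i :: l) = (w j + w i) + listWeight w l := by
      rw [listWeight_cons, listWeight_cons, add_assoc]
    rw [ew]
    refine add_mem (sub_one_mul_listProd_mem hθ hZ hZθ hx hgen ?_ hc l (by simp)) ?_
    · have := (hx j).1; omega
    · refine Submodule.mem_sup_right (mul_mem_augPow hθ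
        (mul_mem_augPow hθ (hZθ _ _ hc) (sub_one_mem_augPow_one _) le_rfl)
        (listProd_mem_augPow hθ hZθ hx l) ?_)
      omega
  | trans h1 h2 ih1 ih2 =>
    rw [← h1.length_eq, ← listWeight_perm h1] at ih2
    simpa using add_mem ih1 ih2

include hθ hZ hZθ hx hgen in
-- The collecting process, by induction on length within a fixed weight. If every index occurs fewer
-- than `p` times, sorting gives a reduced monomial up to shorter products. Otherwise `p` equal
-- factors are brought together and `(θ x - 1) ^ p = θ (x ^ p) - 1` merges them into one factor.
theorem listProd_mem_reducedSpan [CharP A p] {d : ℕ}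
    (hd : augPow (p := p) θ (d + 1) ≤ reducedSpan θ x w (d + 1)) (l : List (Fin N))
    (hl : listWeight w l = d) : listProd θ x l ∈ reducedSpan (p := p) θ x w d := by
  induction hk : l.length using Nat.strong_induction_on generalizing l with
  | _ k ih =>
    subst hk
    have hshort : shortSpan (p := p) θ x w d l.length ≤ reducedSpan θ x w d := by
      refine sup_le (Submodule.span_le.2 ?_) (hd.trans (reducedSpan_antitone (Nat.le_succ d)))
      rintro _ ⟨m, ⟨hm, hml⟩, rfl⟩
      exact ih _ hml m hm rfl
    by_cases hcount : ∀ i, l.count i < p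
    · have hperm : (orderedList fun i => l.count i).Perm l := orderedList_perm
      have h1 := listProd_sub_mem_of_perm hθ hZ hZθ hx hgen hperm.symm
      rw [hl] at h1
      have h2 : listProd θ x (orderedList fun i => l.count i) ∈ reducedSpan (p := p) θ x w d :=
        Submodule.subset_span ⟨fun i => ⟨l.count i, hcount i⟩,
          by simp [listWeight_perm hperm, hl], rfl⟩
      simpa using add_mem (hshort h1) h2
    · push Not at hcount
      obtain ⟨i, hi⟩ := hcount
      obtain ⟨m, hm⟩ : ∃ m, l.Perm (List.replicate p i ++ m) :=
        (List.replicate_sublist_iff.2 hi).exists_perm_append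
      have h1 := listProd_sub_mem_of_perm hθ hZ hZθ hx hgen hm
      have hw := listWeight_perm (w := w) hm
      have h2 : listProd θ x (List.replicate p i ++ m) ∈
          shortSpan (p := p) θ x w d l.length := by
        rw [listProd_append, listProd_replicate,
          sub_pow_char_of_commute p (Commute.one_right _), one_pow, ← map_pow]
        rw [← hl, hw, listWeight_append, listWeight_replicate]
        refine sub_one_mul_listProd_mem hθ hZ hZθ hx hgen ?_ (hZ.pow_mem (hx i).2) m ?_
        · exact Nat.mul_pos hp.out.pos (hx i).1
        · rw [hm.length_eq, List.length_append, List.length_replicate]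
          have := hp.out.two_le
          omega
      rw [hl] at h1
      simpa using add_mem (hshort h1) (hshort h2)

include hθ hZ hZθ hx hgen in
theorem augPow_le_span_sup (d : ℕ) :
    augPow (p := p) θ d ≤ Submodule.span (ZMod p) (listProd θ x '' {l | listWeight w l = d}) ⊔
      augPow θ (d + 1) := by
  induction d with
  | zero =>
    rw [augPow, ← hθ, Submodule.span_le]
    rintro _ ⟨g, rfl⟩
    have : θ g = 1 + (θ g - 1) := by noncomm_ring
    rw [SetLike.mem_coe, this]
    exact add_mem (Submodule.mem_sup_left (Submodule.subset_span ⟨[], rfl, rfl⟩))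
      (Submodule.mem_sup_right (sub_one_mem_augPow_one g))
  | succ d ih =>
    have haug : augmentation (p := p) θ ≤
        Submodule.span (ZMod p) ((fun i => θ (x i) - 1) '' {i | w i = 1}) ⊔ augPow θ 2 := by
      refine Submodule.span_le.2 ?_
      rintro _ ⟨g, rfl⟩
      exact sub_one_mem_span_sup hθ hZ hZθ hx hgen le_rfl (hZ.one ▸ Subgroup.mem_top g)
    rw [augPow]
    refine (mul_le_mul_left ih _).trans ?_
    rw [Submodule.sup_mul]
    refine sup_le ((mul_le_mul_right haug _).trans ?_) le_sup_right
    rw [Submodule.mul_sup, Submodule.span_mul_span]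
    refine sup_le (Submodule.span_le.2 ?_) (le_sup_of_le_right ?_)
    · rintro _ ⟨_, ⟨l, rfl, rfl⟩, _, ⟨i, hi, rfl⟩, rfl⟩
      refine Submodule.mem_sup_left (Submodule.subset_span ⟨l ++ [i], ?_, ?_⟩)
      · rw [Set.mem_ofPred_eq, listWeight_append, listWeight_cons, hi]; simp [listWeight]
      · simp [listProd]
    · refine le_trans (mul_le_mul_left (Submodule.span_le.2 ?_) _) (augPow_mul_augPow hθ d 2)
      rintro _ ⟨l, rfl, rfl⟩
      exact listProd_mem_augPow hθ hZθ hx l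

include hθ hZ hZθ hx hgen in
theorem augPow_le_reducedSpan [CharP A p] {M : ℕ} (hM : augPow (p := p) θ M = ⊥) (d : ℕ) :
    augPow (p := p) θ d ≤ reducedSpan θ x w d := by
  -- Descending induction on `d`, starting where the power of the ideal vanishes.
  suffices H : ∀ k d, M ≤ d + k → augPow (p := p) θ d ≤ reducedSpan θ x w d from
    H M d (Nat.le_add_left _ _)
  intro k
  induction k with
  | zero =>
    intro d hd
    exact (augPow_antitone hθ hd).trans (hM ▸ bot_le)
  | succ k ih =>
    intro d hd
    have h1 := ih (d + 1) (by omega)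
    refine (augPow_le_span_sup hθ hZ hZθ hx hgen d).trans
      (sup_le (Submodule.span_le.2 ?_) (h1.trans (reducedSpan_antitone (Nat.le_succ d))))
    rintro _ ⟨l, hl, rfl⟩
    exact listProd_mem_reducedSpan hθ hZ hZθ hx hgen h1 l hl

include hθ hZ hZθ hx hgen in
/-- If the number of reduced monomials does not exceed the dimension of the algebra, then they form
a basis, and the elements `x i - 1` lie exactly as deep as their weights say. -/
theorem sub_one_notMem_augPow [CharP A p] {M : ℕ} (hM : augPow (p := p) θ M = ⊥)
    (hcard : p ^ N ≤ Module.finrank (ZMod p) A) (i : Fin N) :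
    θ (x i) - 1 ∉ augPow (p := p) θ (w i + 1) := by
  intro hmem
  have hle := augPow_le_reducedSpan hθ hZ hZθ hx hgen hM
  have hind : LinearIndependent (ZMod p)
      (fun a : Fin N → Fin p => listProd θ x (orderedList fun i => a i)) := by
    refine linearIndependent_of_top_le_span_of_card_le_finrank ?_ (by simpa using hcard)
    exact (hle 0).trans (Submodule.span_mono (Set.image_subset_range _ _))
  have h1 : 1 < p := hp.out.one_lt
  -- The exponent vector whose monomial is `θ (x i) - 1` itself. Its weight `w i` keeps it out of
  -- the set of monomials spanning the next power.
  let a : Fin N → Fin p := fun j => if j = i then ⟨1, h1⟩ else ⟨0, hp.out.pos⟩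
  have ha : (orderedList fun j => (a j : ℕ)) = [i] := by
    rw [← orderedList_single]
    congr 1
    funext j
    by_cases h : j = i <;> simp [a, h]
  refine hind.notMem_span_image (s := {a | w i + 1 ≤ listWeight w (orderedList fun i => a i)})
    (x := a) ?_ ?_
  · simp [ha, listWeight]
  · have := hle _ hmem
    simpa [ha, listProd, reducedSpan] using this

end Straightening

/-! ### Jennings' theorem -/

section Jennings

variable {G : Type u} [Group G] {p : ℕ} [hp : Fact p.Prime]

theorem span_range_of : Submodule.span (ZMod p) (Set.range (MonoidAlgebra.of (ZMod p) G)) = ⊤ := by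
  refine eq_top_iff.2 fun a _ => ?_
  induction a using MonoidAlgebra.induction_on with
  | of g => exact Submodule.subset_span ⟨g, rfl⟩
  | add a b ha hb => exact add_mem (ha trivial) (hb trivial)
  | smul r a ha => exact Submodule.smul_mem _ _ (ha trivial)

/-- **Jennings' theorem** for finite groups: if the `n`-th term of the Zassenhaus filtration
vanishes, then so does the `n`-th dimension subgroup modulo `p`. -/
theorem eq_one_of_of_sub_one_mem [Finite G] {n : ℕ} (hn : zassenhaus G p n = ⊥) {g : G}
    (hg : MonoidAlgebra.of (ZMod p) G g - 1 ∈ augPow (p := p) (MonoidAlgebra.of (ZMod p) G) n) :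
    g = 1 := by
  by_contra hne
  have hZ := zassenhaus_isNpSeries (G := G) p
  have hθ := span_range_of (G := G) (p := p)
  have : CharP (MonoidAlgebra (ZMod p) G) p := charP_of_injective_algebraMap
    (algebraMap (ZMod p) (MonoidAlgebra (ZMod p) G)).injective p
  have hZθ : ∀ i, ∀ g ∈ zassenhaus G p i,
      MonoidAlgebra.of (ZMod p) G g - 1 ∈ augPow (p := p) (MonoidAlgebra.of (ZMod p) G) i :=
    fun i g hg => (dimensionSubgroup_isNpSeries p (augPow_isMulFiltration hθ)
      (MonoidAlgebra.of (ZMod p) G) sub_one_mem_augPow_one).zassenhaus_le p i hg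
  have hex : ∃ i, g ∉ zassenhaus G p i := ⟨n, by simpa [hn] using hne⟩
  classical
  -- `m` is the exact depth of `g` in the filtration; it becomes the weight of `g` as a generator.
  obtain ⟨m, hm⟩ : ∃ m, Nat.find hex = m + 1 := Nat.exists_eq_succ_of_ne_zero fun h => by
    have := Nat.find_spec hex
    rw [h, hZ.zero] at this
    exact this (Subgroup.mem_top g)
  have hgm' : g ∉ zassenhaus G p (m + 1) := hm ▸ Nat.find_spec hex
  have hgm : g ∈ zassenhaus G p m := not_not.1 (Nat.find_min hex (by omega))
  have hm1 : 1 ≤ m := Nat.one_le_iff_ne_zero.2 fun h => by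
    rw [h, hZ.one] at hgm'
    exact hgm' (Subgroup.mem_top g)
  have hmn : m + 1 ≤ n := hm ▸ Nat.find_min' hex (by simpa [hn] using hne)
  obtain ⟨xs, h1, h2, h3, h4⟩ := exists_weighted_generators hZ hn hm1 hgm hgm'
  obtain ⟨M, hM⟩ := @exists_augPow_eq_bot G _ p _ (MonoidAlgebra (ZMod p) G) _ _ _ hθ
    (Module.finite_of_finite (ZMod p)) (hZ.isPGroup p hn)
  obtain ⟨i, hi⟩ := List.get_of_mem h1
  have key := sub_one_notMem_augPow (x := fun i => (xs.get i).1) (w := fun i => (xs.get i).2)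
    hθ hZ hZθ (fun i => h2 _ (List.get_mem xs i)) (fun j hj => (h3 j hj).trans
      (Subgroup.closure_mono (Set.union_subset_union_left _ fun y hy => by
        obtain ⟨k, hk⟩ := List.get_of_mem hy
        exact ⟨k, by rw [hk], by rw [hk]⟩))) hM (by
      rw [Module.finrank_eq_nat_card_basis (MonoidAlgebra.basis G (ZMod p))]
      exact h4) i
  rw [hi] at key
  exact key (augPow_antitone hθ hmn hg)

end Jennings

/-! ### Magnus expansion -/

section Magnus

variable {S : Type*} [Group S] {B : Type*} {s : B → S} {p : ℕ} [hp : Fact p.Prime]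
  {G : Type*} [Group G] {A : Type*} [Ring A] [Algebra (ZMod p) A] {θ : G →* A}
  (hθ : Submodule.span (ZMod p) (Set.range θ) = ⊤) (φ : S →* G) (B' : Finset B)
  (c : List B → S → ZMod p)

/-- The homogeneous part of degree `k` of the Magnus expansion with coefficients `c`. -/
def magnusPart (s : B → S) (θ : G →* A) (k : ℕ) (h : S) : A :=
  ∑ w : Fin k → B', c (List.ofFn fun i => (w i : B)) h •
    (List.ofFn fun i => θ (φ (s (w i))) - 1).prod

variable {φ B' c}

include hθ in
theorem magnusPart_mem_augPow (k : ℕ) (h : S) :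
    magnusPart φ B' c s θ k h ∈ augPow (p := p) θ k := by
  refine Submodule.sum_mem _ fun w _ => Submodule.smul_mem _ _ ?_
  clear h
  induction k with
  | zero => exact Submodule.mem_top
  | succ k ih =>
    rw [List.ofFn_succ', List.concat_eq_append, List.prod_append, List.prod_singleton]
    exact mul_mem_augPow hθ (ih (fun i => w i.castSucc) (Finset.mem_univ _))
      (sub_one_mem_augPow_one _) le_rfl

theorem magnusPart_zero (hc0 : ∀ h, c [] h = 1) (h : S) : magnusPart φ B' c s θ 0 h = 1 := by
  simp [magnusPart, hc0]

theorem magnusPart_succ_one (hc1 : ∀ w, w ≠ [] → c w 1 = 0) (k : ℕ) :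
    magnusPart φ B' c s θ (k + 1) 1 = 0 := by
  refine Finset.sum_eq_zero fun w _ => ?_
  rw [hc1 _ (by simp), zero_smul]

/-- Multiplying by `1 + (θ (φ (s a)) - 1)` changes only the coefficients of words ending in `a`.
When `a ∉ B'` no such word is summed, and the extra factor is zero. -/
theorem magnusPart_mul [DecidableEq B] (hφ : ∀ b ∉ B', φ (s b) = 1) {k : ℕ} {h : S} {a : B}
    (hc : ∀ w b, w.length = k →
      c (w ++ [b]) (h * s a) = c (w ++ [b]) h + if b = a then c w h else 0) :
    magnusPart φ B' c s θ (k + 1) (h * s a) = magnusPart φ B' c s θ (k + 1) h +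
      magnusPart φ B' c s θ k h * (θ (φ (s a)) - 1) := by
  have key : ∀ h', magnusPart φ B' c s θ (k + 1) h' = ∑ w : Fin k → B', ∑ b : B',
      c (List.ofFn (fun i => (w i : B)) ++ [(b : B)]) h' •
        ((List.ofFn fun i => θ (φ (s (w i))) - 1).prod * (θ (φ (s b)) - 1)) := by
    intro h'
    rw [magnusPart, ← (Fin.snocEquiv fun _ : Fin (k + 1) => B').sum_comp, Fintype.sum_prod_type,
      Finset.sum_comm]
    refine Finset.sum_congr rfl fun w _ => Finset.sum_congr rfl fun b _ => ?_
    rw [List.ofFn_succ', List.ofFn_succ']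
    simp [Fin.snocEquiv]
  rw [key, key, magnusPart, Finset.sum_mul, ← Finset.sum_add_distrib]
  refine Finset.sum_congr rfl fun w _ => ?_
  simp only [hc _ _ (List.length_ofFn (f := fun i => (w i : B))), add_smul,
    Finset.sum_add_distrib]
  congr 1
  by_cases ha : a ∈ B'
  · rw [Finset.sum_eq_single ⟨a, ha⟩]
    · simp
    · intro b _ hb
      rw [if_neg fun h => hb (Subtype.ext h), zero_smul]
    · simp
  · rw [hφ a ha, map_one, sub_self, mul_zero]
    refine Finset.sum_eq_zero fun b _ => ?_
    rw [if_neg fun h : (b : B) = a => ha (h ▸ b.2), zero_smul]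

include hθ in
/-- The Magnus expansion of an element of the group generated by the `s b`. -/
theorem sub_sum_magnusPart_mem [DecidableEq B] (hφ : ∀ b ∉ B', φ (s b) = 1) {n : ℕ}
    (hc0 : ∀ h, c [] h = 1) (hc1 : ∀ w, w ≠ [] → c w 1 = 0)
    (hc : ∀ h ∈ Subgroup.closure (Set.range s), ∀ w b a, w.length < n →
      c (w ++ [b]) (h * s a) = c (w ++ [b]) h + if b = a then c w h else 0)
    {h : S} (hh : h ∈ Subgroup.closure (Set.range s)) :
    θ (φ h) - ∑ k ∈ Finset.range (n + 1), magnusPart φ B' c s θ k h ∈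
      augPow (p := p) θ (n + 1) := by
  have step : ∀ h ∈ Subgroup.closure (Set.range s), ∀ a,
      (θ (φ (h * s a)) - ∑ k ∈ Finset.range (n + 1), magnusPart φ B' c s θ k (h * s a)) =
      (θ (φ h) - ∑ k ∈ Finset.range (n + 1), magnusPart φ B' c s θ k h) * θ (φ (s a)) +
        magnusPart φ B' c s θ n h * (θ (φ (s a)) - 1) := by
    intro h hh a
    have h1 : ∑ k ∈ Finset.range (n + 1), magnusPart φ B' c s θ k (h * s a) =
        ∑ k ∈ Finset.range (n + 1), magnusPart φ B' c s θ k h +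
          (∑ k ∈ Finset.range n, magnusPart φ B' c s θ k h) * (θ (φ (s a)) - 1) := by
      rw [Finset.sum_range_succ', Finset.sum_range_succ' _ n, magnusPart_zero hc0,
        magnusPart_zero hc0, Finset.sum_mul, add_right_comm, ← Finset.sum_add_distrib]
      congr 1
      refine Finset.sum_congr rfl fun k hk => magnusPart_mul hφ fun w b hw => ?_
      exact hc h hh w b a (by rw [hw]; exact Finset.mem_range.1 hk)
    rw [h1, Finset.sum_range_succ, map_mul, map_mul]
    noncomm_ring
  have last : ∀ h a, magnusPart φ B' c s θ n h * (θ (φ (s a)) - 1) ∈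
      augPow (p := p) θ (n + 1) := fun h a =>
    mul_mem_augPow hθ (magnusPart_mem_augPow hθ n h) (sub_one_mem_augPow_one _) le_rfl
  have hmul : ∀ a ∈ augPow (p := p) θ (n + 1), ∀ b, a * b ∈ augPow (p := p) θ (n + 1) :=
    fun a ha b => mul_mem_augPow hθ ha (j := 0) Submodule.mem_top le_rfl
  induction hh using Subgroup.closure_induction_right with
  | one =>
    rw [Finset.sum_range_succ', magnusPart_zero hc0,
      Finset.sum_eq_zero fun k _ => magnusPart_succ_one hc1 k]
    simp
  | mul_right x hx y hy ih =>
    obtain ⟨a, rfl⟩ := hy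
    rw [step x hx a]
    exact add_mem (hmul _ ih _) (last _ _)
  -- The multiplication formula, applied to `x * (s a)⁻¹` and `s a`, is solved for the error of the
  -- former by cancelling the unit `θ (φ (s a))`.
  | mul_inv_cancel x hx y hy ih =>
    obtain ⟨a, rfl⟩ := hy
    have hxa := mul_mem hx (inv_mem (Subgroup.subset_closure ⟨a, rfl⟩ :
      s a ∈ Subgroup.closure (Set.range s)))
    have h1 := step (x * (s a)⁻¹) hxa a
    rw [inv_mul_cancel_right] at h1
    have h2 := hmul _ (sub_mem ih (last (x * (s a)⁻¹) a)) (θ (φ (s a)⁻¹))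
    rw [h1, add_sub_cancel_right, mul_assoc, ← map_mul, ← map_mul, mul_inv_cancel, map_one,
      map_one, mul_one] at h2
    exact h2

end Magnus

/-! ### Unipotent matrices attached to words -/

section Unipotent

open Matrix

variable {n : ℕ} {R : Type u} [CommRing R]

theorem exists_unipotent_eq {X : Matrix (Fin n) (Fin n) R} (h0 : ∀ i j, j < i → X i j = 0)
    (h1 : ∀ i, X i i = 1) : ∃ g : unipotent n R, g.1.1 = X := by
  have hdet : X.det = 1 := by
    rw [Matrix.det_of_isUpperTriangular fun i j h => h0 i j h]
    simp [h1]
  refine ⟨⟨Matrix.GeneralLinearGroup.mk'' X (by rw [hdet]; exact isUnit_one), h0, h1⟩, rfl⟩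

/-- The unipotent matrix with entry `1` at those positions `(i, i + 1)` at which the `i`-th letter
of the word `w` is `a`, and zeros elsewhere above the diagonal. -/
def wordMatrix {B : Type v} [DecidableEq B] (n : ℕ) (R : Type u) [CommRing R] (w : List B) (a : B) :
    Matrix (Fin n) (Fin n) R :=
  (1 : Matrix (Fin n) (Fin n) R) + Matrix.of fun (i j : Fin n) =>
    if (j : ℕ) = i + 1 ∧ w[(i : ℕ)]? = some a then 1 else 0

variable {B : Type v} [DecidableEq B]

theorem exists_unipotent_eq_wordMatrix (w : List B) (a : B) :
    ∃ g : unipotent n R, g.1.1 = wordMatrix n R w a := by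
  refine exists_unipotent_eq (fun i j h => ?_) fun i => ?_
  · have h' : ¬ (j : ℕ) = i + 1 := by have := Fin.lt_def.1 h; omega
    simp [wordMatrix, h.ne', h']
  · simp [wordMatrix]

variable {S : Type*} [Group S] {s : B → S} {ψ : List B → S →* unipotent n R}

/-- Entries in the first columns depend only on an initial segment of the word. -/
theorem entry_append_eq (hψ : ∀ w a, (ψ w (s a)).1.1 = wordMatrix n R w a) (w : List B) (b : B)
    {h : S} (hh : h ∈ Subgroup.closure (Set.range s)) (i j : Fin n) (hj : (j : ℕ) ≤ w.length) :
    (ψ (w ++ [b]) h).1.1 i j = (ψ w h).1.1 i j := by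
  -- Projection to the columns up to `w.length`. Upper triangular matrices preserve its image, so
  -- agreement on generators propagates to products and inverses.
  let P : Matrix (Fin n) (Fin n) R :=
    Matrix.diagonal fun j => if (j : ℕ) ≤ w.length then 1 else 0
  have hP : ∀ g : unipotent n R, P * (g.1.1 * P) = g.1.1 * P := by
    intro g
    ext i j
    simp only [P, Matrix.diagonal_mul, Matrix.mul_diagonal]
    by_cases hij : j < i
    · simp [g.2.1 i j hij]
    · have := Fin.not_lt.1 hij
      by_cases hj : (j : ℕ) ≤ w.length
      · simp [hj, (show (i : ℕ) ≤ j from this).trans hj]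
      · simp [hj]
  have key : (ψ (w ++ [b]) h).1.1 * P = (ψ w h).1.1 * P := by
    induction hh using Subgroup.closure_induction with
    | mem x hx =>
      obtain ⟨a, rfl⟩ := hx
      rw [hψ, hψ]
      ext i j
      simp only [P, Matrix.mul_diagonal, wordMatrix, Matrix.add_apply, Matrix.of_apply]
      by_cases hj : (j : ℕ) ≤ w.length
      · by_cases hij : (j : ℕ) = i + 1
        · rw [List.getElem?_append_left (by omega)]
        · simp [hij]
      · simp [hj]
    | one => simp
    | mul x y _ _ hx hy =>
      simp only [map_mul, Subgroup.coe_mul, Units.val_mul, Matrix.mul_assoc]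
      rw [hy, ← hP, ← Matrix.mul_assoc, hx, Matrix.mul_assoc, hP]
    | inv x _ hx =>
      have e : ∀ g : unipotent n R, g.1.1 * (g⁻¹).1.1 = 1 := fun g => by
        rw [← Units.val_mul, ← Subgroup.coe_mul, mul_inv_cancel]; rfl
      have e' : ∀ g : unipotent n R, (g⁻¹).1.1 * g.1.1 = 1 := fun g => by
        rw [← Units.val_mul, ← Subgroup.coe_mul, inv_mul_cancel]; rfl
      set X := ψ (w ++ [b]) x
      set Y := ψ w x
      rw [map_inv, map_inv]
      calc (X⁻¹).1.1 * P = (X⁻¹).1.1 * (Y.1.1 * ((Y⁻¹).1.1 * P)) := by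
            rw [← Matrix.mul_assoc Y.1.1, e, Matrix.one_mul]
        _ = (X⁻¹).1.1 * ((Y.1.1 * P) * ((Y⁻¹).1.1 * P)) := by
            rw [Matrix.mul_assoc Y.1.1 P, hP]
        _ = (X⁻¹).1.1 * ((X.1.1 * P) * ((Y⁻¹).1.1 * P)) := by rw [hx]
        _ = (Y⁻¹).1.1 * P := by
            rw [Matrix.mul_assoc X.1.1, ← Matrix.mul_assoc, e', Matrix.one_mul, hP]
  have := congrFun (congrFun key i) j
  simpa [P, Matrix.mul_diagonal, hj] using this

/-- Right multiplication by a word matrix adds a column to the next one exactly when the letters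
match. With `entry_append_eq` this is the recursion for Magnus coefficients. -/
theorem entry_mul_eq (hψ : ∀ w a, (ψ w (s a)).1.1 = wordMatrix n R w a) (w : List B) (b a : B)
    (h : S) (i j k : Fin n) (hj : (j : ℕ) = w.length) (hk : (k : ℕ) = w.length + 1) :
    (ψ (w ++ [b]) (h * s a)).1.1 i k = (ψ (w ++ [b]) h).1.1 i k +
      if b = a then (ψ (w ++ [b]) h).1.1 i j else 0 := by
  rw [map_mul, Subgroup.coe_mul, Units.val_mul, hψ, wordMatrix, Matrix.mul_add, Matrix.mul_one,
    Matrix.add_apply, Matrix.mul_apply, Finset.sum_eq_single j]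
  · by_cases hb : b = a <;> simp [hj, hk, hb]
  · intro l _ hl
    have : ¬ (k : ℕ) = l + 1 := fun h => hl (Fin.ext (by omega))
    simp [this]
  · simp

theorem unipotent_zassenhaus_eq_bot (p : ℕ) [hp : Fact p.Prime] [CharP R p] (hn : 1 ≤ n) :
    zassenhaus (unipotent n R) p n = ⊥ := by
  have : Nonempty (Fin n) := ⟨⟨0, hn⟩⟩
  -- Matrices supported on the `k`-th superdiagonal and above; this is zero for `k = n`.
  let F (k : ℕ) : AddSubgroup (Matrix (Fin n) (Fin n) R) :=
    { carrier := {X | ∀ i j : Fin n, (j : ℕ) < i + k → X i j = 0}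
      zero_mem' := fun _ _ _ => rfl
      add_mem' := fun ha hb i j h => by simp [ha i j h, hb i j h]
      neg_mem' := fun ha i j h => by simp [ha i j h] }
  have hF : IsMulFiltration F :=
    { antitone := fun a b hab X hX i j h => hX i j (by omega)
      mul_mem := fun {a b X Y} hX hY i j h => by
        rw [Matrix.mul_apply]
        refine Finset.sum_eq_zero fun k _ => ?_
        by_cases hk : (k : ℕ) < i + a
        · rw [hX i k hk, zero_mul]
        · rw [hY k j (by omega), mul_zero] }
  let θ : unipotent n R →* Matrix (Fin n) (Fin n) R :=
    (Units.coeHom _).comp (unipotent n R).subtype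
  have hθ : ∀ g, θ g - 1 ∈ F 1 := by
    intro g i j h
    rcases (show j ≤ i from Nat.lt_succ_iff.1 h).eq_or_lt with rfl | h
    · simp [θ, g.2.2]
    · simp [θ, g.2.1 i j h, h.ne']
  refine eq_bot_iff.2 (((dimensionSubgroup_isNpSeries p hF θ hθ).zassenhaus_le p n).trans ?_)
  intro g hg
  have h1 : θ g - 1 = 0 := by
    ext i j
    exact hg i j (by omega)
  exact Subtype.ext (Units.ext (sub_eq_zero.1 h1))

theorem unipotent_isPGroup (p : ℕ) [hp : Fact p.Prime] [CharP R p] (n : ℕ) :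
    IsPGroup p (unipotent n R) := by
  rcases Nat.eq_zero_or_pos n with rfl | hn
  · exact fun g => ⟨0, Subtype.ext (Units.ext (Matrix.ext fun i => i.elim0))⟩
  · exact (zassenhaus_isNpSeries p).isPGroup p (unipotent_zassenhaus_eq_bot p hn)

end Unipotent

/-! ### Detecting elements by word representations -/

section Detection

/-- Let `P` be a finite quotient with `P_{(n,p)} = 1` of a group generated by a family `s`, almost
all of whose members die in `P`. An element that is killed by the representations
`s a ↦ wordMatrix w a`, for the short words `w` in these members, is killed in `P`. -/
theorem eq_one_of_wordMatrix {p : ℕ} [hp : Fact p.Prime] {S B P : Type*} [Group S] [Group P]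
    [Finite P] [DecidableEq B] {s : B → S} (φ : S →* P) (B' : Finset B)
    (hφ : ∀ b ∉ B', φ (s b) = 1) {n : ℕ} (hn : 1 ≤ n) (hP : zassenhaus P p n = ⊥)
    (ψ : List B → S →* unipotent n (ZMod p))
    (hψ : ∀ w a, (ψ w (s a)).1.1 = wordMatrix n (ZMod p) w a) {h : S}
    (hh : h ∈ Subgroup.closure (Set.range s))
    (h1 : ∀ w : List B', w.length < n → ψ (w.map (↑)) h = 1) : φ h = 1 := by
  obtain ⟨n, rfl⟩ : ∃ m, n = m + 1 := ⟨n - 1, by omega⟩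
  let c (w : List B) (h : S) : ZMod p :=
    if hw : w.length < n + 1 then (ψ w h).1.1 0 ⟨w.length, hw⟩ else 0
  have hc : ∀ (w : List B) (h : S) (hw : w.length < n + 1),
      c w h = (ψ w h).1.1 0 ⟨w.length, hw⟩ := fun w h hw => dif_pos hw
  have hc1 : ∀ h w, (w.length < n + 1 → ψ w h = 1) → w ≠ [] → c w h = 0 := by
    intro h w h1 hw
    by_cases hlt : w.length < n + 1
    · rw [hc w h hlt, h1 hlt]
      have : (0 : Fin (n + 1)) ≠ ⟨w.length, hlt⟩ := fun h =>
        hw (List.length_eq_zero_iff.1 (Fin.ext_iff.1 h).symm)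
      exact Matrix.one_apply_ne this
    · exact dif_neg hlt
  have key := sub_sum_magnusPart_mem (span_range_of (G := P) (p := p)) hφ (n := n) (c := c)
    (fun h => by rw [hc [] h (Nat.succ_pos n)]; exact (ψ [] h).2.2 0)
    (fun w hw => hc1 1 w (fun _ => map_one _) hw) (fun h hh w b a hw => by
      have e : (w ++ [b]).length = w.length + 1 := by simp
      rw [hc _ _ (by omega), hc _ _ (by omega), hc _ _ (by omega),
        entry_mul_eq hψ w b a h 0 ⟨w.length, by omega⟩ _ rfl e,
        entry_append_eq hψ w b hh 0 ⟨w.length, by omega⟩ (le_refl w.length)]) hh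
  -- All parts of positive degree vanish, leaving `φ h - 1` in the power `n + 1`, which is the
  -- original `n`.
  rw [Finset.sum_range_succ', Finset.sum_eq_zero, zero_add, magnusPart_zero] at key
  · exact eq_one_of_of_sub_one_mem hP key
  · intro h
    rw [hc [] h (Nat.succ_pos n)]
    exact (ψ [] h).2.2 0
  · intro k _
    refine Finset.sum_eq_zero fun w _ => ?_
    rw [hc1 h _ (fun hlt => ?_) (by simp), zero_smul]
    have e : (List.ofFn fun i => (w i : B)) = (List.ofFn w).map (↑) := by
      rw [List.map_ofFn]; rfl
    rw [e] at hlt ⊢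
    exact h1 _ (by simpa using hlt)

end Detection

/-! ### Finite index in finitely generated groups -/

section Finiteness

variable {G : Type u} [Group G] {p : ℕ} [hp : Fact p.Prime]

/-- In a finitely generated group the terms of a series compatible with commutators and `p`-th
powers have finite index. -/
theorem IsNpSeries.finiteIndex [Group.FG G] {Z : ℕ → Subgroup G} (hZ : IsNpSeries p Z) (i : ℕ) :
    (Z i).FiniteIndex := by
  induction i with
  | zero => rw [hZ.zero]; infer_instance
  | succ i ih =>
    rcases Nat.eq_zero_or_pos i with rfl | hi
    · rw [hZ.one]; infer_instance
    have := hZ.normal p (i + 1)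
    have : Group.FG (Z i) := Subgroup.fg_of_index_ne_zero (Z i)
    -- For `i ≥ 1` this is abelian, since `i + 1 ≤ 2 * i`, and of exponent dividing `p`. It is
    -- finitely generated because `Z i` has finite index, so it is finite.
    let Q := Z i ⧸ (Z (i + 1)).subgroupOf (Z i)
    let _ : CommGroup Q :=
      { (inferInstance : Group Q) with
        mul_comm := fun a b => by
          induction a using QuotientGroup.induction_on with | H a =>
          induction b using QuotientGroup.induction_on with | H b =>
          rw [← QuotientGroup.mk_mul, ← QuotientGroup.mk_mul, QuotientGroup.eq,
            Subgroup.mem_subgroupOf]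
          have h := hZ.antitone (by omega : i + 1 ≤ i + i)
            (hZ.commutator (inv_mem b.2) (inv_mem a.2))
          simpa [commutatorElement_def, mul_assoc] using h }
    have hfin : Finite Q := by
      refine CommGroup.finite_of_fg_isMulTorsion Q fun a => ?_
      induction a using QuotientGroup.induction_on with | H a =>
      refine isOfFinOrder_iff_pow_eq_one.2 ⟨p, hp.out.pos, ?_⟩
      refine (QuotientGroup.eq_one_iff _).2 ?_
      rw [Subgroup.mem_subgroupOf]
      exact hZ.pow_mem_succ p a.2
    rw [Subgroup.finiteIndex_iff, ← Subgroup.relIndex_mul_index (hZ.antitone (Nat.le_succ i))]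
    exact mul_ne_zero (Subgroup.finiteIndex_iff_finite_quotient.2 hfin).index_ne_zero
      ih.index_ne_zero

end Finiteness

/-! ### Kernel intersections for free discrete groups -/

section KernelIntersections

variable {p : ℕ} [hp : Fact p.Prime] {S : Type u} [Group S]

theorem zassenhaus_le_ker {n : ℕ} (hn : 1 ≤ n) (φ : S →* unipotent n (ZMod p)) :
    zassenhaus S p n ≤ φ.ker := by
  have := (((zassenhaus_isNpSeries p).comap p φ).zassenhaus_le p n)
  rwa [unipotent_zassenhaus_eq_bot p hn, MonoidHom.comap_bot] at this

theorem closedZassenhaus_le_ker [TopologicalSpace S] [IsTopologicalGroup S] {n : ℕ} (hn : 1 ≤ n)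
    (φ : S →* unipotent n (ZMod p)) (hφ : Continuous[inferInstance, ⊥] φ) :
    closedZassenhaus S p n ≤ φ.ker := by
  have := (((zassenhaus_isNpSeries p).comap p φ).closedZassenhaus_le p (fun i =>
    Subgroup.isClosed_of_isOpen _ (@IsOpen.preimage _ _ _ ⊥ _ hφ _ trivial)) n)
  rwa [unipotent_zassenhaus_eq_bot p hn, MonoidHom.comap_bot] at this

theorem zassenhaus_quotient_eq_bot {Z : ℕ → Subgroup S} (hZ : IsNpSeries p Z) {n : ℕ}
    {N : Subgroup S} [N.Normal] (hN : Z n ≤ N) : zassenhaus (S ⧸ N) p n = ⊥ := by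
  refine eq_bot_iff.2 (((hZ.map p (QuotientGroup.mk' N)
    (QuotientGroup.mk'_surjective N)).zassenhaus_le p n).trans ?_)
  rw [Subgroup.map_le_iff_le_comap, MonoidHom.comap_bot, QuotientGroup.ker_mk']
  exact hN

theorem zassenhaus_eq_kerInt {B : Type v} [Finite B] (b : FreeGroupBasis B S) {n : ℕ}
    (hn : 1 ≤ n) : zassenhaus S p n = kerInt S (unipotent n (ZMod p)) := by
  refine le_antisymm (le_iInf fun φ => zassenhaus_le_ker hn φ) fun h hh => ?_
  classical
  have hcl : Subgroup.closure (Set.range b) = ⊤ := by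
    have : Set.range b = b.repr.symm.toMonoidHom '' Set.range FreeGroup.of := by
      rw [← Set.range_comp]; rfl
    rw [this, ← MonoidHom.map_closure, FreeGroup.closure_range_of,
      Subgroup.map_top_of_surjective _ b.repr.symm.surjective]
  have hZ := zassenhaus_isNpSeries (G := S) p
  have : Group.FG S := Group.fg_iff.2 ⟨_, hcl, Set.finite_range b⟩
  have := hZ.normal p n
  have := hZ.finiteIndex n
  have := Subgroup.finite_quotient_of_finiteIndex (H := zassenhaus S p n)
  let _ := Fintype.ofFinite B
  choose U hU using exists_unipotent_eq_wordMatrix (B := B) (n := n) (R := ZMod p)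
  refine (QuotientGroup.eq_one_iff h).1 (eq_one_of_wordMatrix
    (QuotientGroup.mk' (zassenhaus S p n)) Finset.univ (s := b) (by simp) hn
    (zassenhaus_quotient_eq_bot hZ le_rfl) (fun w => b.lift (U w)) (fun w a => ?_)
    (hcl ▸ Subgroup.mem_top h) fun w _ => ?_)
  · rw [← hU, show b.lift (U w) (b a) = U w a from congrFun (b.lift.symm_apply_apply (U w)) a]
  · exact (Subgroup.mem_iInf.1 hh _ :)

end KernelIntersections

/-! ### Free pro-`𝓒` groups -/

section Profinite

variable {S : Type u} [Group S] [TopologicalSpace S] [IsTopologicalGroup S]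

theorem exists_open_normal_notMem [CompactSpace S] [TotallyDisconnectedSpace S] {C : Subgroup S}
    [C.Normal] (hC : IsClosed (C : Set S)) {g : S} (hg : g ∉ C) :
    ∃ N : Subgroup S, N.Normal ∧ IsOpen (N : Set S) ∧ C ≤ N ∧ g ∉ N := by
  obtain ⟨H, hH⟩ := ProfiniteGrp.exist_openNormalSubgroup_sub_open_nhds_of_one
    (U := (fun x => g * x) ⁻¹' (C : Set S)ᶜ)
    (hC.isOpen_compl.preimage (continuous_const_mul g)) (by simpa using hg)
  have hHn : H.toSubgroup.Normal := inferInstance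
  refine ⟨C ⊔ H.toSubgroup, inferInstance, ?_, le_sup_left, fun h => ?_⟩
  · exact Subgroup.isOpen_mono (le_sup_right : H.toSubgroup ≤ _) H.isOpen
  · obtain ⟨c, hc, x, hx, rfl⟩ := Subgroup.mem_sup_of_normal_right.1 h
    exact hH (inv_mem hx : x⁻¹ ∈ H.toSubgroup) (by simpa using hc)

theorem isProC_of_isPGroup {primes : Set ℕ} {p : ℕ} [hp : Fact p.Prime] (hpp : p ∈ primes)
    {H : Type u} [Group H] [Finite H] (hH : IsPGroup p H) [TopologicalSpace H]
    [IsTopologicalGroup H] [DiscreteTopology H] : IsProC primes H where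
  compact := inferInstance
  hausdorff := inferInstance
  totallyDisconnected := inferInstance
  quotients N hN _ q hq hqd := by
    obtain ⟨k, hk⟩ := IsPGroup.iff_card.1 (hH.to_quotient N)
    rw [hk] at hqd
    rwa [(Nat.prime_dvd_prime_iff_eq hq hp.out).1 (hq.dvd_of_dvd_pow hqd)]

/-- A free pro-`𝓒` group has homomorphisms to finite `p`-groups, for `p` among the given primes,
with prescribed values on the basis, almost all of them trivial. -/
theorem IsFreeProC.exists_lift {primes : Set ℕ} {p : ℕ} [hp : Fact p.Prime] (hpp : p ∈ primes)
    {B : Type v} {ι : B → S} (h : IsFreeProC primes ι) {H : Type} [Group H] [Finite H]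
    (hH : IsPGroup p H) (f : B → H) (hf : {b | f b ≠ 1}.Finite) :
    ∃ φ : S →* H, Continuous[inferInstance, ⊥] φ ∧ ∀ b, φ (ι b) = f b := by
  -- The universal property only speaks of groups in the universe of `S`, hence the lift.
  let _ : TopologicalSpace (ULift.{u} H) := ⊥
  have : DiscreteTopology (ULift.{u} H) := ⟨rfl⟩
  have hU : IsPGroup p (ULift.{u} H) := hH.of_equiv MulEquiv.ulift.symm
  obtain ⟨φ, hφ, -⟩ := h.lift (ULift.{u} H) (isProC_of_isPGroup hpp hU) (fun b => ULift.up (f b))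
    fun N _ _ => hf.subset fun b hb h1 => hb (by
      have : ULift.up.{u} (f b) = 1 := by rw [h1]; rfl
      simp only [this, one_mem])
  refine ⟨MulEquiv.ulift.toMonoidHom.comp φ.toMonoidHom, ?_, fun b => ?_⟩
  · let _ : TopologicalSpace H := ⊥
    exact (continuous_of_discreteTopology (f := (MulEquiv.ulift : ULift.{u} H ≃* H))).comp
      φ.continuous_toFun
  · exact congrArg ULift.down (hφ b)

omit [IsTopologicalGroup S] in
theorem mem_kerIntCont {H : Type v} [Group H] {g : S} :
    g ∈ kerIntCont S H ↔ ∀ φ : S →* H, Continuous[inferInstance, ⊥] φ → φ g = 1 := by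
  simp [kerIntCont, Subgroup.mem_iInf, MonoidHom.mem_ker]

theorem closedZassenhaus_eq_kerIntCont {p : ℕ} [hp : Fact p.Prime] {primes : Set ℕ} {B : Type v}
    {ι : B → S} (h : IsFreeProC primes ι) {n : ℕ} (hn : 1 ≤ n) :
    closedZassenhaus S p n = kerIntCont S (unipotent n (ZMod p)) := by
  refine le_antisymm (le_iInf₂ fun φ hφ => closedZassenhaus_le_ker hn φ hφ) fun g hg => ?_
  classical
  by_contra hgC
  have := h.isProC.compact
  have := h.isProC.totallyDisconnected
  have hZ := closedZassenhaus_isNpSeries (G := S) p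
  have := hZ.normal p n
  obtain ⟨N, hN, hNo, hCN, hgN⟩ :=
    exists_open_normal_notMem (isClosed_closedZassenhaus (G := S) p n) hgC
  have hP := zassenhaus_quotient_eq_bot (p := p) hZ hCN
  have := Subgroup.quotient_finite_of_isOpen N hNo
  have hPp : IsPGroup p (S ⧸ N) := (zassenhaus_isNpSeries p).isPGroup p hP
  -- `S ⧸ N` is a nontrivial `p`-group, as `g` survives in it. If `p` is not among the primes, no
  -- such `g` exists.
  have hpp : p ∈ primes := by
    refine h.isProC.quotients N hN hNo p hp.out ?_
    obtain ⟨k, hk⟩ := IsPGroup.iff_card.1 hPp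
    rw [hk]
    refine dvd_pow_self p fun hk0 => hgN ?_
    rw [hk0, pow_zero] at hk
    have := (Nat.card_eq_one_iff_unique.1 hk).1
    exact (QuotientGroup.eq_one_iff g).1 (Subsingleton.elim _ _)
  let B' := (h.convergesToOne N hN hNo).toFinset
  choose U hU using exists_unipotent_eq_wordMatrix (B := B) (n := n) (R := ZMod p)
  -- A letter not occurring in `w` has trivial word matrix, so almost all basis elements go to `1`.
  choose ψ hψc hψ using fun w => h.exists_lift hpp (unipotent_isPGroup (R := ZMod p) p n) (U w)
    (w.toFinset.finite_toSet.subset fun b hb => by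
      by_contra hbw
      refine hb (Subtype.ext (Units.ext ?_))
      rw [hU]
      ext i j
      have : w[(i : ℕ)]? ≠ some b := fun h => hbw (by
        simpa using List.mem_of_getElem? h)
      simp [wordMatrix, this])
  have hW : {w : List B' | w.length < n}.Finite := List.finite_length_lt _ n
  -- Only finitely many words in `B'` matter, so the conditions on `g` that the detection lemma uses
  -- cut out an open set, which meets the dense abstract subgroup.
  have hO : IsOpen ({x : S | (x : S ⧸ N) = g} ∩
      ⋂ w ∈ {w : List B' | w.length < n}, ψ (w.map (↑)) ⁻¹' {1}) := by
    refine IsOpen.inter ?_ (hW.isOpen_biInter fun w _ =>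
      @IsOpen.preimage _ _ _ ⊥ _ (hψc _) _ trivial)
    have : {x : S | (x : S ⧸ N) = g} = (fun x => g⁻¹ * x) ⁻¹' (N : Set S) := by
      ext x
      rw [Set.mem_ofPred_eq, eq_comm, QuotientGroup.eq]
      rfl
    rw [this]
    exact hNo.preimage (continuous_const_mul _)
  have hgO : g ∈ {x : S | (x : S ⧸ N) = g} ∩
      ⋂ w ∈ {w : List B' | w.length < n}, ψ (w.map (↑)) ⁻¹' {1} :=
    ⟨rfl, Set.mem_iInter₂.2 fun w _ => mem_kerIntCont.1 hg _ (hψc _)⟩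
  have hdense : g ∈ closure (Subgroup.closure (Set.range ι) : Set S) := by
    rw [← Subgroup.topologicalClosure_coe, h.generates]
    trivial
  obtain ⟨x, ⟨hxg, hxW⟩, hx⟩ := mem_closure_iff.1 hdense _ hO hgO
  refine hgN ((QuotientGroup.eq_one_iff g).1 ?_)
  rw [← (hxg : (x : S ⧸ N) = g)]
  refine eq_one_of_wordMatrix (QuotientGroup.mk' N) B' (fun b hb => ?_) hn hP ψ
    (fun w a => by rw [hψ, hU]) hx fun w hw => Set.mem_iInter₂.1 hxW w hw
  refine (QuotientGroup.eq_one_iff _).2 ?_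
  by_contra hbN
  exact hb ((Set.Finite.mem_toFinset _).2 hbN)

end Profinite

/-! ### A coordinate model of `U_3` -/

section HeisenbergModel

/-- The Heisenberg group over `R`, with the unipotent matrix `[[1, a, c], [0, 1, b], [0, 0, 1]]`
recorded by its three entries. -/
@[ext]
structure Heis (R : Type u) where
  a : R
  b : R
  c : R

namespace Heis

variable {R : Type u} [CommRing R]

instance : Group (Heis R) where
  mul x y := ⟨x.a + y.a, x.b + y.b, x.c + y.c + x.a * y.b⟩
  one := ⟨0, 0, 0⟩
  inv x := ⟨-x.a, -x.b, -x.c + x.a * x.b⟩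
  mul_assoc x y z := by
    refine Heis.ext (add_assoc _ _ _) (add_assoc _ _ _) ?_
    change x.c + y.c + x.a * y.b + z.c + (x.a + y.a) * z.b =
      x.c + (y.c + z.c + y.a * z.b) + x.a * (y.b + z.b)
    ring
  one_mul x := by
    refine Heis.ext (zero_add _) (zero_add _) ?_
    change 0 + x.c + 0 * x.b = x.c
    ring
  mul_one x := by
    refine Heis.ext (add_zero _) (add_zero _) ?_
    change x.c + 0 + x.a * 0 = x.c
    ring
  inv_mul_cancel x := by
    refine Heis.ext (neg_add_cancel _) (neg_add_cancel _) ?_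
    change -x.c + x.a * x.b + x.c + -x.a * x.b = 0
    ring

@[simp] theorem one_a : (1 : Heis R).a = 0 := rfl
@[simp] theorem one_b : (1 : Heis R).b = 0 := rfl
@[simp] theorem one_c : (1 : Heis R).c = 0 := rfl
@[simp] theorem mul_a (x y : Heis R) : (x * y).a = x.a + y.a := rfl
@[simp] theorem mul_b (x y : Heis R) : (x * y).b = x.b + y.b := rfl
@[simp] theorem mul_c (x y : Heis R) : (x * y).c = x.c + y.c + x.a * y.b := rfl

omit [CommRing R] in
theorem card_eq : Nat.card (Heis R) = Nat.card R ^ 3 := by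
  let e : Heis R ≃ R × R × R :=
    { toFun := fun x => (x.a, x.b, x.c)
      invFun := fun x => ⟨x.1, x.2.1, x.2.2⟩ }
  rw [Nat.card_congr e, Nat.card_prod, Nat.card_prod]
  ring

/-- The Heisenberg group as a group of matrices. -/
def toMatrix : Heis R →* Matrix (Fin 3) (Fin 3) R where
  toFun x := !![1, x.a, x.c; 0, 1, x.b; 0, 0, 1]
  map_one' := by
    ext i j
    fin_cases i <;> fin_cases j <;> simp
  map_mul' x y := by
    ext i j
    fin_cases i <;> fin_cases j <;> simp [Matrix.mul_apply, Fin.sum_univ_three] <;> ring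

theorem nonempty_mulEquiv_unipotent : Nonempty (Heis R ≃* unipotent 3 R) := by
  let f : Heis R →* unipotent 3 R := (toMatrix.toHomUnits).codRestrict _ fun x => by
    refine ⟨fun i j h => ?_, fun i => ?_⟩
    · fin_cases i <;> fin_cases j <;> first | rfl | simp at h
    · fin_cases i <;> rfl
  have hf : ∀ x, (f x).1.1 = !![1, x.a, x.c; 0, 1, x.b; 0, 0, 1] := fun x => rfl
  refine ⟨MulEquiv.ofBijective f ⟨fun x y h => ?_, fun g => ?_⟩⟩
  · have h' : (f x).1.1 = (f y).1.1 := by rw [h]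
    rw [hf, hf] at h'
    exact Heis.ext (congrFun (congrFun h' 0) 1) (congrFun (congrFun h' 1) 2)
      (congrFun (congrFun h' 0) 2)
  · refine ⟨⟨g.1.1 0 1, g.1.1 1 2, g.1.1 0 2⟩, Subtype.ext (Units.ext ?_)⟩
    rw [hf]
    have h1 := g.2.2
    have h0 := g.2.1
    ext i j
    fin_cases i <;> fin_cases j <;> simp [h1, h0]

end Heis

end HeisenbergModel

/-! ### Recognizing the Heisenberg group -/

section HeisenbergHom

variable {H : Type*} [Group H] {x y z : H}

theorem pow_mul_pow_eq (hzx : Commute z x) (hzy : Commute z y) (hxy : x * y = z * y * x)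
    (m n : ℕ) : x ^ m * y ^ n = z ^ (m * n) * y ^ n * x ^ m := by
  have h1 : ∀ n, x * y ^ n = z ^ n * y ^ n * x := by
    intro n
    induction n with
    | zero => simp
    | succ n ih =>
      calc x * y ^ (n + 1) = x * y ^ n * y := by rw [pow_succ, mul_assoc]
        _ = z ^ n * y ^ n * (x * y) := by rw [ih]; group
        _ = z ^ n * (y ^ n * z) * (y * x) := by rw [hxy]; group
        _ = z ^ n * (z * y ^ n) * (y * x) := by rw [(hzy.pow_right n).eq]
        _ = z ^ (n + 1) * y ^ (n + 1) * x := by rw [pow_succ, pow_succ]; group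
  induction m with
  | zero => simp
  | succ m ih =>
    calc x ^ (m + 1) * y ^ n = x ^ m * (x * y ^ n) := by rw [pow_succ, mul_assoc]
      _ = x ^ m * z ^ n * (y ^ n * x) := by rw [h1]; group
      _ = z ^ n * (x ^ m * y ^ n) * x := by rw [← ((hzx.pow_right m).pow_left n).eq]; group
      _ = z ^ ((m + 1) * n) * y ^ n * x ^ (m + 1) := by
        rw [ih, add_mul, one_mul, add_comm, pow_add, pow_succ]; group

/-- A group of order `p ^ 3` generated by elements of order `p` satisfying the Heisenberg relations
is the Heisenberg group over `𝔽_p`. -/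
theorem nonempty_heis_mulEquiv {p : ℕ} [hp : Fact p.Prime] (hzx : Commute z x)
    (hzy : Commute z y) (hxy : x * y = z * y * x) (hx : x ^ p = 1) (hy : y ^ p = 1)
    (hz : z ^ p = 1) (hz1 : z ≠ 1) (hcard : Nat.card H = p ^ 3) :
    Nonempty (Heis (ZMod p) ≃* H) := by
  have hadd : ∀ {g : H}, g ^ p = 1 → ∀ i j : ZMod p, g ^ (i + j).val = g ^ i.val * g ^ j.val := by
    intro g hg i j
    rw [ZMod.val_add, ← pow_eq_pow_mod _ hg, pow_add]
  have hmul : ∀ i j : ZMod p, z ^ (i * j).val = z ^ (i.val * j.val) := by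
    intro i j
    rw [ZMod.val_mul, ← pow_eq_pow_mod _ hz]
  let f : Heis (ZMod p) →* H :=
    { toFun := fun g => z ^ g.c.val * y ^ g.b.val * x ^ g.a.val
      map_one' := by simp
      map_mul' := fun g h => by
        simp only [Heis.mul_a, Heis.mul_b, Heis.mul_c, hadd hx, hadd hy, hadd hz, hmul]
        calc _ = z ^ g.c.val * (z ^ h.c.val * (z ^ (g.a.val * h.b.val) * y ^ g.b.val)) *
                y ^ h.b.val * x ^ g.a.val * x ^ h.a.val := by group
          _ = z ^ g.c.val * (z ^ h.c.val * y ^ g.b.val) * (z ^ (g.a.val * h.b.val) *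
                y ^ h.b.val * x ^ g.a.val) * x ^ h.a.val := by
              rw [((hzy.pow_right _).pow_left _).eq]; group
          _ = z ^ g.c.val * y ^ g.b.val * (z ^ h.c.val * x ^ g.a.val) * y ^ h.b.val *
                x ^ h.a.val := by
              rw [← pow_mul_pow_eq hzx hzy hxy, ((hzy.pow_right _).pow_left _).eq]; group
          _ = _ := by rw [((hzx.pow_right _).pow_left _).eq]; group }
  have hval : ∀ i : ZMod p, z ^ i.val = 1 → i = 0 := by
    intro i hi
    have := orderOf_dvd_of_pow_eq_one hi
    rw [orderOf_eq_prime hz hz1] at this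
    exact (ZMod.val_eq_zero i).1 (Nat.eq_zero_of_dvd_of_lt this (ZMod.val_lt i))
  have hinj : Function.Injective f := by
    refine (injective_iff_map_eq_one f).2 fun g hg => ?_
    have hg' : z ^ g.c.val * y ^ g.b.val * x ^ g.a.val = 1 := hg
    -- The relation makes `y ^ b` a product of powers of `z` and `x`, so it commutes with `x`;
    -- comparison with the commutation formula forces `z ^ b = 1`.
    have hb : g.b = 0 := by
      refine hval _ ?_
      have h1 := pow_mul_pow_eq hzx hzy hxy 1 g.b.val
      rw [pow_one, one_mul] at h1
      have e1 : y ^ g.b.val = (z ^ g.c.val)⁻¹ * (x ^ g.a.val)⁻¹ := by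
        rw [eq_inv_mul_iff_mul_eq, eq_inv_iff_mul_eq_one]
        exact hg'
      have e2 : Commute x (y ^ g.b.val) := by
        rw [e1]
        exact ((hzx.symm.pow_right _).inv_right).mul_right
          (((Commute.refl x).pow_right _).inv_right)
      rw [e2.eq, mul_assoc] at h1
      exact (right_eq_mul.1 h1)
    have hg2 := hg'
    rw [hb, ZMod.val_zero, pow_zero, mul_one] at hg2
    have ha : g.a = 0 := by
      refine hval _ ?_
      have h1 := pow_mul_pow_eq hzx hzy hxy g.a.val 1
      rw [pow_one, mul_one] at h1
      have e1 : x ^ g.a.val = (z ^ g.c.val)⁻¹ := by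
        rw [eq_inv_iff_mul_eq_one, ← ((hzx.pow_right _).pow_left _).eq]
        exact hg2
      have e2 : Commute (x ^ g.a.val) y := by
        rw [e1]
        exact (hzy.pow_left _).inv_left
      rw [mul_assoc, ← e2.eq] at h1
      exact (right_eq_mul.1 h1)
    rw [ha, ZMod.val_zero, pow_zero, mul_one] at hg2
    exact Heis.ext ha hb (hval _ hg2)
  have : Finite H := Nat.finite_of_card_ne_zero (by rw [hcard]; exact pow_ne_zero _ hp.out.ne_zero)
  exact ⟨MulEquiv.ofBijective f ((Nat.bijective_iff_injective_and_card f).2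
    ⟨hinj, by rw [Heis.card_eq, Nat.card_zmod, hcard]⟩)⟩

end HeisenbergHom

/-! ### Subgroups of `U_3` -/

section SmallGroups

variable {p : ℕ} [hp : Fact p.Prime]

theorem nonempty_unipotent_mulEquiv_dihedral :
    Nonempty (unipotent 3 (ZMod 2) ≃* DihedralGroup 4) := by
  obtain ⟨e⟩ := Heis.nonempty_mulEquiv_unipotent (R := ZMod 2)
  obtain ⟨f⟩ := nonempty_heis_mulEquiv (p := 2) (x := (DihedralGroup.sr 0 : DihedralGroup 4))
    (y := DihedralGroup.sr 1) (z := DihedralGroup.r 2) (by rw [commute_iff_eq]; decide)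
    (by rw [commute_iff_eq]; decide) (by decide) (by decide) (by decide) (by decide) (by decide)
    (by rw [DihedralGroup.nat_card]; norm_num)
  exact ⟨e.symm.trans f⟩

omit hp in
theorem natCard_unipotent_three : Nat.card (unipotent 3 (ZMod p)) = p ^ 3 := by
  obtain ⟨e⟩ := Heis.nonempty_mulEquiv_unipotent (R := ZMod p)
  rw [← Nat.card_congr e.toEquiv, Heis.card_eq, Nat.card_zmod]

theorem unipotent_three_pow_eq_one (h2 : 2 < p) (g : unipotent 3 (ZMod p)) : g ^ p = 1 := by
  have hZ := zassenhaus_isNpSeries (G := unipotent 3 (ZMod p)) p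
  have h1 : g ^ p ∈ zassenhaus (unipotent 3 (ZMod p)) p (p * 1) :=
    hZ.pow_mem (hZ.one ▸ Subgroup.mem_top g)
  have h3 := hZ.antitone (by omega : 3 ≤ p * 1) h1
  rwa [unipotent_zassenhaus_eq_bot p (by omega), Subgroup.mem_bot] at h3

omit hp in
theorem isHeisenberg_of_mulEquiv {H K : Type} [Group H] [Group K] (e : H ≃* K)
    (h : IsHeisenberg p K) : IsHeisenberg p H := by
  obtain ⟨h1, h2, a, b, hab⟩ := h
  refine ⟨by rw [Nat.card_congr e.toEquiv, h1], by rw [Monoid.exponent_eq_of_mulEquiv e, h2],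
    e.symm a, e.symm b, fun h => hab ?_⟩
  rwa [← map_mul, ← map_mul, e.symm.injective.eq_iff] at h

theorem isHeisenberg_unipotent (h2 : 2 < p) : IsHeisenberg p (unipotent 3 (ZMod p)) := by
  have hne : ∃ a b : unipotent 3 (ZMod p), a * b ≠ b * a := by
    obtain ⟨e⟩ := Heis.nonempty_mulEquiv_unipotent (R := ZMod p)
    refine ⟨e ⟨1, 0, 0⟩, e ⟨0, 1, 0⟩, fun h => ?_⟩
    rw [← map_mul, ← map_mul, e.injective.eq_iff] at h
    simpa using congrArg Heis.c h
  refine ⟨natCard_unipotent_three, ?_, hne⟩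
  refine ((Nat.dvd_prime hp.out).1 (Monoid.exponent_dvd_of_forall_pow_eq_one
    (unipotent_three_pow_eq_one h2))).resolve_left fun h1 => ?_
  obtain ⟨a, b, hab⟩ := hne
  have := Monoid.exp_eq_one_iff.1 h1
  exact hab (Subsingleton.elim _ _)

/-- A nonabelian group of order `p ^ 3` and exponent `p` is the Heisenberg group. -/
theorem IsHeisenberg.nonempty_mulEquiv {H : Type} [Group H] (h : IsHeisenberg p H) :
    Nonempty (H ≃* unipotent 3 (ZMod p)) := by
  obtain ⟨hcard, hexp, x, y, hxy⟩ := h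
  have : Finite H := Nat.finite_of_card_ne_zero (by rw [hcard]; exact pow_ne_zero _ hp.out.ne_zero)
  -- The centre of a nontrivial `p`-group is nontrivial, so this quotient has order dividing `p ^ 2`
  -- and is abelian; hence commutators in `H` are central.
  have hcomm : IsMulCommutative (H ⧸ Subgroup.center H) := by
    obtain ⟨k, hk, hZ⟩ := IsPGroup.card_center_eq_prime_pow hcard three_pos
    obtain ⟨j, hj⟩ := IsPGroup.iff_card.1
      ((IsPGroup.of_card hcard).to_quotient (Subgroup.center H))
    have hjk : j + k = 3 := by
      have := (Subgroup.center H).index_mul_card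
      rw [hcard, hZ, Subgroup.index_eq_card, hj, ← pow_add] at this
      exact Nat.pow_right_injective hp.out.two_le this
    obtain hj2 | hj2 : j = 2 ∨ j ≤ 1 := by omega
    · exact IsPGroup.isMulCommutative_of_card_eq_prime_sq (hj2 ▸ hj)
    · have : IsCyclic (H ⧸ Subgroup.center H) := isCyclic_of_card_dvd_prime (p := p) (by
        rw [hj]; simpa using pow_dvd_pow p hj2)
      exact IsCyclic.isMulCommutative
  have hz : ⁅x, y⁆ ∈ Subgroup.center H := by
    rw [← QuotientGroup.eq_one_iff, ← QuotientGroup.mk'_apply, map_commutatorElement,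
      commutatorElement_eq_one_iff_mul_comm]
    exact hcomm.is_comm.comm _ _
  have hpow : ∀ g : H, g ^ p = 1 := fun g => by rw [← hexp]; exact Monoid.pow_exponent_eq_one g
  obtain ⟨e⟩ := Heis.nonempty_mulEquiv_unipotent (R := ZMod p)
  obtain ⟨f⟩ := nonempty_heis_mulEquiv (x := x) (y := y) (z := ⁅x, y⁆)
    (Subgroup.mem_center_iff.1 hz x).symm (Subgroup.mem_center_iff.1 hz y).symm
    (by rw [commutatorElement_def]; group) (hpow _) (hpow _) (hpow _)
    (fun h => hxy (commutatorElement_eq_one_iff_mul_comm.1 h)) hcard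
  exact ⟨f.symm.trans e⟩

theorem nonempty_linearEquiv_zmod_prod {V : Type*} [AddCommGroup V] [Module (ZMod p) V]
    (hcard : Nat.card V = p ^ 2) : Nonempty (V ≃ₗ[ZMod p] ZMod p × ZMod p) := by
  have : Finite V :=
    Nat.finite_of_card_ne_zero (by rw [hcard]; exact pow_ne_zero _ hp.out.ne_zero)
  refine FiniteDimensional.nonempty_linearEquiv_of_finrank_eq ?_
  have h1 := Module.natCard_eq_pow_finrank (K := ZMod p) (V := V)
  rw [Nat.card_zmod, hcard] at h1
  rw [Module.finrank_prod, Module.finrank_self]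
  exact (Nat.pow_right_injective hp.out.two_le h1).symm

theorem nonempty_mulEquiv_cyclicSq {K : Type*} [Group K] (hcard : Nat.card K = p ^ 2)
    (hexp : ∀ x : K, x ^ p = 1) : Nonempty (K ≃* Multiplicative (ZMod p × ZMod p)) := by
  let _ := IsPGroup.commGroupOfCardEqPrimeSq hcard
  let _ : Module (ZMod p) (Additive K) := AddCommGroup.zmodModule fun x => hexp x.toMul
  obtain ⟨e⟩ := nonempty_linearEquiv_zmod_prod (p := p) (V := Additive K) hcard
  exact ⟨e.toAddEquiv.toMultiplicativeRight⟩

/-- The orders and the structure of the subgroups of a group of order `p ^ 3`. -/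
theorem subgroup_cases {U : Type*} [Group U] (hU : Nat.card U = p ^ 3) (H : Subgroup U) :
    Nonempty (H ≃* Multiplicative (ZMod 1)) ∨ Nonempty (H ≃* Multiplicative (ZMod p)) ∨
      Nat.card H = p ^ 2 ∨ H = ⊤ := by
  have : Finite U := Nat.finite_of_card_ne_zero (by rw [hU]; exact pow_ne_zero _ hp.out.ne_zero)
  obtain ⟨k, hk3, hk⟩ := (Nat.dvd_prime_pow hp.out).1 (hU ▸ H.card_subgroup_dvd_card)
  interval_cases k
  · left
    rw [pow_zero, Nat.card_eq_one_iff_unique] at hk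
    have := hk.1
    exact ⟨⟨⟨fun _ => 1, fun _ => 1, fun _ => Subsingleton.elim _ _, fun _ => Subsingleton.elim _ _⟩,
      fun _ _ => Subsingleton.elim _ _⟩⟩
  · right; left
    rw [pow_one] at hk
    exact ⟨mulEquivOfPrimeCardEq hk (Nat.card_zmod p)⟩
  · exact Or.inr (Or.inr (Or.inl hk))
  · exact Or.inr (Or.inr (Or.inr (Subgroup.eq_top_of_card_eq H (by rw [hk, hU]))))

theorem nonempty_mulEquiv_cyclic_four {K : Type*} [Group K] (hcard : Nat.card K = 2 ^ 2)
    (hexp : ¬ ∀ x : K, x ^ 2 = 1) : Nonempty (K ≃* Multiplicative (ZMod 4)) := by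
  push Not at hexp
  obtain ⟨x, hx⟩ := hexp
  have : Finite K := Nat.finite_of_card_ne_zero (by rw [hcard]; simp)
  have hord : orderOf x = Nat.card K := by
    obtain ⟨k, hk2, hk⟩ := (Nat.dvd_prime_pow Nat.prime_two).1 (hcard ▸ orderOf_dvd_natCard x)
    have h2 : ¬ k ≤ 1 := fun h => hx (orderOf_dvd_iff_pow_eq_one.1 (by
      rw [hk]; exact pow_dvd_pow 2 h |>.trans (by simp)))
    rw [hk, hcard, show k = 2 by omega]
  have := isCyclic_of_orderOf_eq_card x hord
  exact ⟨mulEquivOfCyclicCardEq (by rw [hcard]; exact (Nat.card_zmod 4).symm)⟩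

theorem exists_subgroup_of_injective {M U : Type*} [Group M] [Group U] (f : M →* U)
    (hf : Function.Injective f) : ∃ H : Subgroup U, Nonempty (M ≃* H) :=
  ⟨f.range, ⟨MonoidHom.ofInjective hf⟩⟩

theorem exists_subgroup_unipotent_cyclicSq :
    ∃ H : Subgroup (unipotent 3 (ZMod p)), Nonempty (cyclicSq p ≃* H) := by
  obtain ⟨e⟩ := Heis.nonempty_mulEquiv_unipotent (R := ZMod p)
  let f : Multiplicative (ZMod p × ZMod p) →* Heis (ZMod p) :=
    { toFun := fun x => ⟨0, x.toAdd.1, x.toAdd.2⟩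
      map_one' := rfl
      map_mul' := fun x y => by ext <;> simp }
  refine exists_subgroup_of_injective (e.toMonoidHom.comp f) (e.injective.comp fun x y h => ?_)
  exact Multiplicative.toAdd.injective (Prod.ext (congrArg Heis.b h) (congrArg Heis.c h))

theorem exists_subgroup_unipotent_cyclic :
    ∃ H : Subgroup (unipotent 3 (ZMod p)), Nonempty (cyclic p ≃* H) := by
  obtain ⟨e⟩ := Heis.nonempty_mulEquiv_unipotent (R := ZMod p)
  let f : Multiplicative (ZMod p) →* Heis (ZMod p) :=
    { toFun := fun x => ⟨0, 0, x.toAdd⟩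
      map_one' := rfl
      map_mul' := fun x y => by ext <;> simp }
  refine exists_subgroup_of_injective (e.toMonoidHom.comp f) (e.injective.comp fun x y h => ?_)
  exact Multiplicative.toAdd.injective (congrArg Heis.c h)

theorem exists_subgroup_cyclic_one {U : Type*} [Group U] :
    ∃ H : Subgroup U, Nonempty (cyclic 1 ≃* H) :=
  exists_subgroup_of_injective (1 : Multiplicative (ZMod 1) →* U)
    (Function.injective_of_subsingleton _)

theorem exists_subgroup_mulEquiv_iff {U : Type*} [Group U] {L : Set GrpCat.{0}}
    (h1 : ∀ H : Subgroup U, ∃ M ∈ L, Nonempty (H ≃* M))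
    (h2 : ∀ M ∈ L, ∃ H : Subgroup U, Nonempty (M ≃* H)) (K : GrpCat.{0}) :
    (∃ H : Subgroup U, Nonempty (K ≃* H)) ↔ ∃ M ∈ L, Nonempty (K ≃* M) := by
  constructor
  · rintro ⟨H, ⟨e⟩⟩
    obtain ⟨M, hM, ⟨f⟩⟩ := h1 H
    exact ⟨M, hM, ⟨e.trans f⟩⟩
  · rintro ⟨M, hM, ⟨e⟩⟩
    obtain ⟨H, ⟨f⟩⟩ := h2 M hM
    exact ⟨H, ⟨e.trans f⟩⟩

theorem exists_subgroup_iff_listTwo (K : GrpCat.{0}) :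
    (∃ H : Subgroup (unipotent 3 (ZMod 2)), Nonempty (K ≃* H)) ↔
      ∃ M ∈ insert (cyclicSq 2) listTwo, Nonempty (K ≃* M) := by
  obtain ⟨e⟩ := nonempty_unipotent_mulEquiv_dihedral
  refine exists_subgroup_mulEquiv_iff (fun H => ?_) (fun M hM => ?_) K
  · rcases subgroup_cases (p := 2) natCard_unipotent_three H with h | h | h | rfl
    · exact ⟨cyclic 1, by simp [listTwo], h⟩
    · exact ⟨cyclic 2, by simp [listTwo], h⟩
    · by_cases hexp : ∀ x : H, x ^ 2 = 1
      · exact ⟨cyclicSq 2, by simp, nonempty_mulEquiv_cyclicSq h hexp⟩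
      · exact ⟨cyclic 4, by simp [listTwo], nonempty_mulEquiv_cyclic_four h hexp⟩
    · exact ⟨GrpCat.of (DihedralGroup 4), by simp [listTwo], ⟨Subgroup.topEquiv.trans e⟩⟩
  · rcases hM with rfl | rfl | rfl | rfl | rfl
    · exact exists_subgroup_unipotent_cyclicSq
    · exact exists_subgroup_cyclic_one
    · exact exists_subgroup_unipotent_cyclic
    · let f : Multiplicative (ZMod 4) →* DihedralGroup 4 :=
        { toFun := fun x => DihedralGroup.r x.toAdd
          map_one' := rfl
          map_mul' := fun x y => by simp }
      refine exists_subgroup_of_injective (e.symm.toMonoidHom.comp f)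
        (e.symm.injective.comp fun x y h => ?_)
      exact Multiplicative.toAdd.injective (DihedralGroup.r.inj h)
    · exact ⟨⊤, ⟨e.symm.trans Subgroup.topEquiv.symm⟩⟩

theorem exists_subgroup_iff_listOdd (h2 : 2 < p) (K : GrpCat.{0}) :
    (∃ H : Subgroup (unipotent 3 (ZMod p)), Nonempty (K ≃* H)) ↔
      ∃ M ∈ insert (cyclicSq p) (listOdd p), Nonempty (K ≃* M) := by
  refine exists_subgroup_mulEquiv_iff (fun H => ?_) (fun M hM => ?_) K
  · rcases subgroup_cases natCard_unipotent_three H with h | h | h | rfl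
    · exact ⟨cyclic 1, by simp [listOdd], h⟩
    · exact ⟨cyclic p, by simp [listOdd], h⟩
    · exact ⟨cyclicSq p, by simp, nonempty_mulEquiv_cyclicSq h fun x =>
        Subtype.ext (unipotent_three_pow_eq_one h2 x.1)⟩
    · exact ⟨GrpCat.of (unipotent 3 (ZMod p)), Or.inr (Or.inr (isHeisenberg_unipotent h2)),
        ⟨Subgroup.topEquiv⟩⟩
  · rcases hM with rfl | (rfl | rfl) | hM
    · exact exists_subgroup_unipotent_cyclicSq
    · exact exists_subgroup_cyclic_one
    · exact exists_subgroup_unipotent_cyclic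
    · obtain ⟨e⟩ := IsHeisenberg.nonempty_mulEquiv hM
      exact ⟨⊤, ⟨e.trans Subgroup.topEquiv.symm⟩⟩

end SmallGroups

/-! ### Kernel intersections as list kernels -/

section ListKernels

variable {S : Type u} [Group S] [TopologicalSpace S]

theorem mem_listKernel {L : Set GrpCat.{0}} {g : S} : g ∈ listKernel S L ↔
    ∀ K ∈ L, ∀ φ : S →* K, Continuous[inferInstance, ⊥] φ → Function.Surjective φ → φ g = 1 := by
  simp [listKernel, Subgroup.mem_iInf, MonoidHom.mem_ker]

theorem continuous_bot_comp {X Y Z : Type*} [TopologicalSpace X] {f : X → Y}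
    (hf : Continuous[inferInstance, ⊥] f) (k : Y → Z) : Continuous[inferInstance, ⊥] (k ∘ f) :=
  @Continuous.comp _ _ _ _ ⊥ ⊥ _ _ continuous_bot hf

/-- A homomorphism to `U` is an epimorphism onto its image, which is isomorphic to a member of `L`;
conversely, members of `L` embed in `U`. -/
theorem kerIntCont_eq_listKernel {U : Type} [Group U] {L : Set GrpCat.{0}}
    (hL : ∀ K : GrpCat.{0}, (∃ H : Subgroup U, Nonempty (K ≃* H)) ↔ ∃ M ∈ L, Nonempty (K ≃* M)) :
    kerIntCont S U = listKernel S L := by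
  ext g
  rw [mem_kerIntCont, mem_listKernel]
  constructor
  · intro h M hM φ hφ _
    obtain ⟨H, ⟨e⟩⟩ := (hL M).2 ⟨M, hM, ⟨MulEquiv.refl _⟩⟩
    have h1 := h ((H.subtype.comp e.toMonoidHom).comp φ)
      (continuous_bot_comp hφ (H.subtype.comp e.toMonoidHom))
    exact e.injective (Subtype.ext (by simpa using h1))
  · intro h φ hφ
    obtain ⟨M, hM, ⟨e⟩⟩ := (hL (GrpCat.of φ.range)).1 ⟨φ.range, ⟨MulEquiv.refl _⟩⟩
    have hc : Continuous[inferInstance, ⊥] φ.rangeRestrict := by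
      refine @continuous_def _ _ _ ⊥ _ |>.2 fun s _ => ?_
      have : φ.rangeRestrict ⁻¹' s = φ ⁻¹' (Subtype.val '' s) := by
        ext x
        refine ⟨fun h => ⟨_, h, rfl⟩, fun ⟨y, hy, h⟩ => ?_⟩
        rwa [show y = φ.rangeRestrict x from Subtype.ext h] at hy
      rw [this]
      exact @IsOpen.preimage _ _ _ ⊥ _ hφ _ trivial
    have h1 := h M hM (e.toMonoidHom.comp φ.rangeRestrict) (continuous_bot_comp hc e)
      (e.surjective.comp φ.rangeRestrict_surjective)
    have h2 : φ.rangeRestrict g = 1 := e.injective (by simpa using h1)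
    exact congrArg Subtype.val h2

/-- The two coordinates of an epimorphism onto `(ℤ/m)²` are epimorphisms onto `ℤ/m`, and their
kernels intersect in its kernel. -/
theorem listKernel_insert_cyclicSq {m : ℕ} {L : Set GrpCat.{0}} (hm : cyclic m ∈ L) :
    listKernel S (insert (cyclicSq m) L) = listKernel S L := by
  ext g
  rw [mem_listKernel, mem_listKernel]
  refine ⟨fun h K hK => h K (Or.inr hK), fun h K hK => ?_⟩
  rcases hK with rfl | hK
  · intro φ hφ hs
    let p1 : Multiplicative (ZMod m × ZMod m) →* Multiplicative (ZMod m) :=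
      AddMonoidHom.toMultiplicative (AddMonoidHom.fst _ _)
    let p2 : Multiplicative (ZMod m × ZMod m) →* Multiplicative (ZMod m) :=
      AddMonoidHom.toMultiplicative (AddMonoidHom.snd _ _)
    have h1 := h _ hm (p1.comp φ) (continuous_bot_comp hφ p1)
      ((show Function.Surjective p1 from
        Prod.fst_surjective (α := ZMod m) (β := ZMod m)).comp hs)
    have h2 := h _ hm (p2.comp φ) (continuous_bot_comp hφ p2)
      ((show Function.Surjective p2 from
        Prod.snd_surjective (α := ZMod m) (β := ZMod m)).comp hs)
    exact Multiplicative.toAdd.injective (Prod.ext h1 h2)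
  · exact h K hK

end ListKernels

end ZassenhausKernel

open ZassenhausKernel in
theorem mainTheorem4 (p : ℕ) [Fact p.Prime] :
    -- free discrete groups on a finite set
    (∀ (A : Type v) (S : Type u) [Group S] [Finite A], FreeGroupBasis A S →
      ∀ n : ℕ, 1 ≤ n → zassenhaus S p n = kerInt S (unipotent n (ZMod p))) ∧
    -- free pro-`𝓒` groups on an arbitrary set
    (∀ (primes : Set ℕ) (_ : ∀ q ∈ primes, q.Prime) (A : Type v) (S : Type u) [Group S]
      [TopologicalSpace S] [IsTopologicalGroup S] (ι : A → S), IsFreeProC primes ι →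
      ∀ n : ℕ, 1 ≤ n → closedZassenhaus S p n = kerIntCont S (unipotent n (ZMod p))) ∧
    -- the group `U_3(𝔽_p)` and its subgroups, up to isomorphism
    (p = 2 → Nonempty (unipotent 3 (ZMod p) ≃* DihedralGroup 4) ∧
      ∀ K : GrpCat.{0}, (∃ H : Subgroup (unipotent 3 (ZMod p)), Nonempty (K ≃* H)) ↔
        ∃ M ∈ insert (cyclicSq 2) listTwo, Nonempty (K ≃* M)) ∧
    (2 < p → (∀ H : GrpCat.{0}, IsHeisenberg p H ↔ Nonempty (H ≃* unipotent 3 (ZMod p))) ∧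
      ∀ K : GrpCat.{0}, (∃ H : Subgroup (unipotent 3 (ZMod p)), Nonempty (K ≃* H)) ↔
        ∃ M ∈ insert (cyclicSq p) (listOdd p), Nonempty (K ≃* M)) ∧
    -- free profinite groups and `n = 3`
    (∀ (A : Type v) (S : Type u) [Group S] [TopologicalSpace S] [IsTopologicalGroup S]
      (ι : A → S), IsFreeProC {q | q.Prime} ι →
      closedZassenhaus S p 3 = kerIntCont S (unipotent 3 (ZMod p)) ∧
      (p = 2 → closedZassenhaus S p 3 = listKernel S (insert (cyclicSq 2) listTwo) ∧
        closedZassenhaus S p 3 = listKernel S listTwo) ∧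
      (2 < p → closedZassenhaus S p 3 = listKernel S (insert (cyclicSq p) (listOdd p)) ∧
        closedZassenhaus S p 3 = listKernel S (listOdd p))) := by
  refine ⟨fun A S _ _ b n hn => zassenhaus_eq_kerInt b hn,
    fun primes _ A S _ _ _ ι h n hn => closedZassenhaus_eq_kerIntCont h hn, ?_, ?_, ?_⟩
  · rintro rfl
    exact ⟨nonempty_unipotent_mulEquiv_dihedral, exists_subgroup_iff_listTwo⟩
  · intro h2
    exact ⟨fun H => ⟨IsHeisenberg.nonempty_mulEquiv, fun ⟨e⟩ =>
      isHeisenberg_of_mulEquiv e (isHeisenberg_unipotent h2)⟩, exists_subgroup_iff_listOdd h2⟩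
  · intro A S _ _ _ ι h
    have h3 := closedZassenhaus_eq_kerIntCont (p := p) h (n := 3) (by omega)
    refine ⟨h3, ?_, fun h2 => ?_⟩
    · rintro rfl
      have h4 := h3.trans (kerIntCont_eq_listKernel exists_subgroup_iff_listTwo)
      exact ⟨h4, h4.trans (listKernel_insert_cyclicSq (by simp [listTwo]))⟩
    · have h4 := h3.trans (kerIntCont_eq_listKernel (exists_subgroup_iff_listOdd h2))
      exact ⟨h4, h4.trans (listKernel_insert_cyclicSq (by simp [listOdd]))⟩
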